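/- Let $F$ be an algebraically closed field of characteristic $2$ and let $n\ge 4$ be even. Let $\mathbb{D}_n$ be the Coxeter group of type $D_n$, realised as the group of permutations of $\{\pm1,\dots,\pm n\}$ generated by the set $T$ consisting of $u=(-2,1)(-1,2)$ and $t_i=(i,i+1)(-i,-(i+1))$ for $1\le i\le n-1$, and let $\ell$ be the word length with respect to $T$. For $J\subseteq T$ put \[X_J=\{w\in\mathbb{D}_n:\ \ell(ws)>\ell(w)\text{ for all }s\in J\},\qquad x_J=\sum_{w\in X_J}w\in F\mathbb{D}_n .\] Let $\mathscr{D}_F(\mathbb{D}_n)$ be the descent algebra of $\mathbb{D}_n$ over $F$, that is, the subalgebra of the group algebra $F\mathbb{D}_n$ generated by all $x_J$, $J\subseteq T$ (by a theorem of Solomon, it is the $F$-linear span of the $x_J$). The Ext-quiver of a finite-dimensional $F$-algebra $A$ is the quiver whose vertices are the isomorphism classes of simple (left) $A$-modules and in which the number of arrows from $S$ to $S'$ is $\dim_F\mathsf{Ext}^1_A(S,S')$. Then the Ext-quiver of $\mathscr{D}_F(\mathbb{D}_n)$ has exactly one vertex, and at that vertex there are at least $n$ loops. -/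

import Mathlib

universe u

open CategoryTheory

noncomputable section

/-! ### Descent algebras -/

section Descent

variable {W : Type*} [Group W]

/-- The length of `w` with respect to the generating set `S`: the least length of a word in the
elements of `S` whose product is `w`. -/
def wordLength (S : Set W) (w : W) : ℕ :=
  sInf {k : ℕ | ∃ l : List W, (∀ s ∈ l, s ∈ S) ∧ l.prod = w ∧ l.length = k}

/-- The set `X_J` of distinguished (minimal length) representatives of the left cosets of
`W_J = ⟨J⟩`, that is, all `w` such that `ℓ(ws) > ℓ(w)` for every `s ∈ J`. -/
def distinguishedReps (S J : Set W) : Set W :=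
  {w : W | ∀ s ∈ J, wordLength S w < wordLength S (w * s)}

variable [Finite W]

/-- The element `x_J = ∑_{w ∈ X_J} w` of the group algebra `F W`. -/
def descentElement (F : Type*) [Field F] (S J : Set W) : MonoidAlgebra F W :=
  ∑ w ∈ (Set.toFinite (distinguishedReps S J)).toFinset, MonoidAlgebra.of F W w

/-- The descent algebra of the finite Coxeter system `(W, S)` over `F`, as a subalgebra of the group
algebra `F W`: the subalgebra generated by the elements `x_J`, `J ⊆ S`. (By Solomon's theorem, the
linear span of the `x_J` is closed under multiplication, so this is exactly their span.) -/
def descentAlgebra (F : Type*) [Field F] (S : Set W) : Subalgebra F (MonoidAlgebra F W) :=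
  Algebra.adjoin F {x | ∃ J : Set W, J ⊆ S ∧ x = descentElement F S J}

end Descent

/-! ### The Coxeter group of type `D_n`

It is realised by signed permutations, that is, as a group of permutations of
`[-n,-1] ∪ [1,n]`; all other integers are fixed. -/

/-- The generator `t_i = (i, i+1)(-i, -(i+1))`. -/
def typeDSimple (i : ℤ) : Equiv.Perm ℤ :=
  Equiv.swap i (i + 1) * Equiv.swap (-i) (-(i + 1))

/-- The generator `u = (-2, 1)(-1, 2)`. -/
def typeDFork : Equiv.Perm ℤ :=
  Equiv.swap (-2) 1 * Equiv.swap (-1) 2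

/-- The set `{u, t_1, …, t_{n-1}}` of Coxeter generators. -/
def typeDGenerators (n : ℕ) : Set (Equiv.Perm ℤ) :=
  {σ | σ = typeDFork ∨ ∃ i : ℕ, 1 ≤ i ∧ i < n ∧ σ = typeDSimple i}

/-- The Coxeter group of type `D_n` (`n ≥ 4`). -/
abbrev TypeD (n : ℕ) : Type :=
  Subgroup.closure (typeDGenerators n)

/-- The Coxeter generators, as elements of the group of type `D_n`. -/
def TypeD.generators (n : ℕ) : Set (TypeD n) :=
  {w | (w : Equiv.Perm ℤ) ∈ typeDGenerators n}

theorem typeD_fixes (n : ℕ) (σ : Equiv.Perm ℤ) (hσ : σ ∈ Subgroup.closure (typeDGenerators n)) :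
    ∀ x : ℤ, ¬ (x ∈ Set.Icc (-(n + 2 : ℤ)) (n + 2)) → σ x = x := by
  induction hσ using Subgroup.closure_induction with
  | mem σ h =>
    intro x hx
    rw [Set.mem_Icc] at hx
    rcases h with rfl | ⟨i, h1, h2, rfl⟩
    · have h : Equiv.swap (-1 : ℤ) 2 x = x :=
        Equiv.swap_apply_of_ne_of_ne (by omega) (by omega)
      rw [typeDFork, Equiv.Perm.mul_apply, h]
      exact Equiv.swap_apply_of_ne_of_ne (by omega) (by omega)
    · have h : Equiv.swap (-(i : ℤ)) (-(i + 1)) x = x :=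
        Equiv.swap_apply_of_ne_of_ne (by omega) (by omega)
      rw [typeDSimple, Equiv.Perm.mul_apply, h]
      exact Equiv.swap_apply_of_ne_of_ne (by omega) (by omega)
  | one => intro x _; rfl
  | mul σ τ _ _ h1 h2 =>
    intro x hx
    rw [Equiv.Perm.mul_apply, h2 x hx, h1 x hx]
  | inv σ _ h =>
    intro x hx
    rw [Equiv.Perm.inv_eq_iff_eq, h x hx]

instance typeD_finite (n : ℕ) : Finite (TypeD n) := by
  let p : ℤ → Prop := fun x => x ∈ Set.Icc (-(n + 2 : ℤ)) (n + 2)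
  have : Finite (Subtype p) := (Set.finite_Icc (-(n + 2 : ℤ)) (n + 2)).to_subtype
  have : Finite {f : Equiv.Perm ℤ // ∀ a, ¬ p a → f a = a} :=
    Finite.of_equiv _ (Equiv.Perm.subtypeEquivSubtypePerm p)
  exact Finite.of_injective
    (fun w : TypeD n =>
      (⟨w.1, typeD_fixes n w.1 w.2⟩ : {f : Equiv.Perm ℤ // ∀ a, ¬ p a → f a = a}))
    (fun a b h => Subtype.ext (congrArg (fun z => z.1) h))

/-- The descent algebra of type `D_n` over `F`. -/
abbrev descentAlgebraD (F : Type u) [Field F] (n : ℕ) : Type u :=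
  descentAlgebra F (TypeD.generators n)

/-! ### The Ext-quiver -/

section ExtQuiver

variable (A : Type u) [Ring A]

/-- The simple `A`-modules. -/
abbrev SimpleMod : Type (u + 1) :=
  {M : ModuleCat.{u} A // IsSimpleModule A M}

/-- Isomorphism of simple `A`-modules. -/
def simpleModSetoid : Setoid (SimpleMod A) where
  r M N := Nonempty (M.1 ≅ N.1)
  iseqv :=
    ⟨fun M => ⟨Iso.refl M.1⟩, fun ⟨e⟩ => ⟨e.symm⟩, fun ⟨e⟩ ⟨f⟩ => ⟨e.trans f⟩⟩

/-- The vertices of the Ext-quiver of the `F`-algebra `A`: the isomorphism classes of simple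
`A`-modules. -/
@[nolint unusedArguments]
def ExtQuiver (F : Type u) [Field F] (A : Type u) [Ring A] [Algebra F A] : Type (u + 1) :=
  Quotient (simpleModSetoid A)

variable {A} {F : Type u} [Field F] [Algebra F A]

/-- A simple module in the given isomorphism class. -/
def ExtQuiver.simpleModule (v : ExtQuiver F A) : ModuleCat.{u} A :=
  (Quotient.out (s := simpleModSetoid A) v).1

/-- The number of arrows from `S` to `T` in the Ext-quiver is `dim_F Ext¹_A(S, T)`. -/
instance ExtQuiver.instQuiver : Quiver (ExtQuiver F A) where
  Hom S T := Fin (Module.finrank F (Abelian.Ext S.simpleModule T.simpleModule 1))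

end ExtQuiver

end

/-! ### Local algebras: the simple module and its self-extensions -/

section LocalAlgebra

variable {F : Type u} [Field F] {A : Type u} [Ring A] [Algebra F A]

open scoped ModuleCat

/-! The point is that the `x_J` form a basis with `x_T = 1`, and that for `J ≠ T` the product `x_J
x_K` involves only `x_L` with `L` strictly inside `K`. Granting this, the coefficient of `1` is an
augmentation, left multiplication by its kernel `N` strictly lowers supports, and so `N` is
nilpotent: the algebra is local with a single simple module `S`. Elements of `N * N` are supported
on sets missing at least two generators, so the coefficients at the `n` sets `T \ {s}` are
independent functionals on `N / N²`. Since `N` kills `S`, the sequence `0 → N → A → S → 0` gives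
`Ext¹(S, S) ≅ Hom_A(N, S)`, which therefore has dimension at least `n` (`card_le_finrank_ext_one`,
`exists_unique_vertex_of_triangular_basis`).

The triangularity comes from the monoid of faces of the reflection arrangement under the Tits
product. Sending a face to the group element of its projection of the base chamber turns the sum of
the faces of type `J` into `x_J`. The coefficient of `x_L` in `x_J x_K` is then the number of pairs
`(f, g)` of faces of types `J`, `K` with `g * f = φ L` (`IsFaceSystem.setSum_mul_setSum_eq_sum`).
Such a pair forces `g = φ K` and `L ⊆ K`. For `L = K` one counts faces `f` with `φ K * f = φ K`, a
set stable under `f ↦ -f`. For even `n` the group contains `-1`, so `-f` again has type `J`; only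
the trivial face is its own negative, so for `J ≠ T` the count is even and vanishes in
characteristic `2` (`IsFaceSystem.card_factorizations_self`).

The rest checks that type `D_n` supplies such a system of faces, with points encoded as odd
functions on the integers and roots as pairs of indices. -/

theorem ker_augmentation_le_of_isMaximal (ε : A →ₐ[F] F)
    (hnil : ∀ x, ε x = 0 → IsNilpotent x) (I : Ideal A) (hI : I.IsMaximal) :
    I = RingHom.ker ε := by
  have hle : RingHom.ker ε ≤ I := by
    intro x hx
    by_contra hxI
    obtain ⟨y, hy⟩ := (Ideal.isMaximal_iff.1 hI).2 (I ⊔ Ideal.span {x}) x le_sup_left hxI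
      (Ideal.mem_sup_right (Ideal.mem_span_singleton_self x)) |> Submodule.mem_sup.1
    obtain ⟨hyI, z, hz, hyz⟩ := hy
    obtain ⟨a, rfl⟩ := Ideal.mem_span_singleton'.1 hz
    have hn : IsNilpotent (a * x) := hnil _ (by
      rw [map_mul, RingHom.mem_ker.1 hx, mul_zero])
    -- If `x` lay outside `I`, then `1 = y + a * x` with `y` in `I`; as `a * x` is nilpotent, `y`
    -- would be a unit.
    have hu : IsUnit y := by
      have : y = 1 - a * x := by rw [← hyz]; abel
      rw [this]
      exact hn.isUnit_one_sub
    exact hI.ne_top (Ideal.eq_top_of_isUnit_mem _ hyI hu)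
  have hker : (RingHom.ker ε).IsMaximal := by
    refine Ideal.isMaximal_iff.2 ⟨by simp [RingHom.mem_ker], fun J x hJ hx hxJ => ?_⟩
    have hx0 : ε x ≠ 0 := fun h => hx (RingHom.mem_ker.2 h)
    have h1 : (1 : A) - (algebraMap F A (ε x)⁻¹) * x ∈ J := hJ (by
      rw [RingHom.mem_ker, map_sub, map_mul, AlgHom.commutes, map_one, Algebra.algebraMap_self,
        RingHom.id_apply, inv_mul_cancel₀ hx0, sub_self])
    simpa using J.add_mem h1 (J.mul_mem_left (algebraMap F A (ε x)⁻¹) hxJ)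
  exact (hker.eq_of_le hI.ne_top hle).symm

theorem nonempty_linearEquiv_quotient_ker (ε : A →ₐ[F] F)
    (hnil : ∀ x, ε x = 0 → IsNilpotent x) (M : Type u) [AddCommGroup M] [Module A M]
    [IsSimpleModule A M] : Nonempty (M ≃ₗ[A] A ⧸ (RingHom.ker ε : Ideal A)) := by
  obtain ⟨I, hI, ⟨e⟩⟩ := isSimpleModule_iff_quot_maximal.1 (inferInstance : IsSimpleModule A M)
  obtain rfl := ker_augmentation_le_of_isMaximal ε hnil I hI
  exact ⟨e⟩

/-- The generator `m` of a module killed by the augmentation ideal turns a functional that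
vanishes on products of elements of the augmentation ideal into an `A`-linear map. -/
def augmentationIdealHom (ε : A →ₐ[F] F) (φ : A →ₗ[F] F)
    (hφ : ∀ x y, ε x = 0 → ε y = 0 → φ (x * y) = 0) {M : Type u} [AddCommGroup M] [Module A M]
    (m : M) (hm : ∀ x, ε x = 0 → x • m = 0) : (RingHom.ker ε : Ideal A) →ₗ[A] M where
  toFun x := algebraMap F A (φ x) • m
  map_add' x y := by simp [add_smul]
  map_smul' a x := by
    have hx : ε x = 0 := RingHom.mem_ker.1 x.2
    -- Both `a - ε a` and `x` lie in the augmentation ideal, so `φ` kills their product.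
    have h1 : φ (a * x) = ε a * φ x := by
      have := hφ (a - algebraMap F A (ε a)) x (by simp) hx
      rw [sub_mul, map_sub, sub_eq_zero] at this
      rw [this, ← Algebra.smul_def, map_smul, smul_eq_mul]
    have h2 : a • m = algebraMap F A (ε a) • m := by
      have := hm (a - algebraMap F A (ε a)) (by simp)
      rwa [sub_smul, sub_eq_zero] at this
    simp only [Submodule.coe_smul, smul_eq_mul, RingHom.id_apply]
    rw [h1, mul_comm, map_mul, mul_smul, ← h2, ← mul_smul, ← mul_smul, Algebra.commutes]

/-- Apply `Hom(-, M)` to `0 → N → A → M → 0`. Restriction `Hom(A, M) → Hom(N, M)` is zero because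
`N` kills `M`, and `Ext¹(A, M) = 0`, so the connecting map `Φ` is an isomorphism; the functionals `φ
i` yield independent elements of its source. -/
theorem card_le_finrank_ext_one [Module.Finite F A] (ε : A →ₐ[F] F)
    {ι : Type*} [Fintype ι] [DecidableEq ι] (φ : ι → A →ₗ[F] F)
    (hφ : ∀ i x y, ε x = 0 → ε y = 0 → φ i (x * y) = 0) (y : ι → A) (hy : ∀ i, ε (y i) = 0)
    (hφy : ∀ i j, φ i (y j) = if i = j then 1 else 0)
    (M : ModuleCat.{u} A) (e : M ≃ₗ[A] A ⧸ (RingHom.ker ε : Ideal A)) :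
    Fintype.card ι ≤ Module.finrank F (Abelian.Ext M M 1) := by
  let N : Ideal A := RingHom.ker ε
  let m : M := e.symm (Submodule.Quotient.mk 1)
  have hNM : ∀ x, ε x = 0 → ∀ z : M, x • z = 0 := by
    intro x hx z
    obtain ⟨z, rfl⟩ := e.symm.surjective z
    obtain ⟨a, rfl⟩ := Submodule.Quotient.mk_surjective _ z
    rw [← map_smul, ← Submodule.Quotient.mk_smul,
      (Submodule.Quotient.mk_eq_zero _).2 (RingHom.mem_ker.2 (by simp [hx])), map_zero]
  have hm : ∀ c : F, algebraMap F A c • m = 0 → c = 0 := by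
    intro c hc
    rw [← map_smul, e.symm.map_eq_zero_iff, ← Submodule.Quotient.mk_smul,
      Submodule.Quotient.mk_eq_zero, RingHom.mem_ker] at hc
    simpa using hc
  let g : A →ₗ[A] M := e.symm.toLinearMap ∘ₗ N.mkQ
  let S : ShortComplex (ModuleCat.{u} A) := ShortComplex.mk
    (ModuleCat.ofHom N.subtype : ModuleCat.of A N ⟶ ModuleCat.of A A) (ModuleCat.ofHom g) (by
      ext x
      exact (e.symm.map_eq_zero_iff).2 ((Submodule.Quotient.mk_eq_zero N).2 x.2))
  have hS : S.ShortExact :=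
    { exact := by
        rw [ShortComplex.moduleCat_exact_iff]
        intro x hx
        have hx' : e.symm (N.mkQ x) = 0 := hx
        rw [e.symm.map_eq_zero_iff, Submodule.mkQ_apply, Submodule.Quotient.mk_eq_zero] at hx'
        exact ⟨⟨x, hx'⟩, rfl⟩
      mono_f := (ModuleCat.mono_iff_injective _).2 (Submodule.injective_subtype N)
      epi_g := (ModuleCat.epi_iff_surjective _).2
        (e.symm.surjective.comp (Submodule.mkQ_surjective N)) }
  let Φ : (ModuleCat.of A N ⟶ M) →ₗ[F] Abelian.Ext M M 1 :=
    (Abelian.Ext.precompOfLinear hS.extClass F M (add_zero 1)).comp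
      (Abelian.Ext.linearEquiv₀ (R := F)).symm.toLinearMap
  have hΦ : ∀ f, Φ f = hS.extClass.comp (Abelian.Ext.mk₀ f) (add_zero 1) := fun f => rfl
  have hinj : LinearMap.ker Φ = ⊥ := by
    rw [LinearMap.ker_eq_bot']
    intro f hf
    rw [hΦ] at hf
    obtain ⟨x₂, hx₂⟩ := Abelian.Ext.contravariant_sequence_exact₁ hS M _ _ hf
    obtain ⟨h, rfl⟩ := (Abelian.Ext.mk₀_bijective _ _).2 x₂
    rw [Abelian.Ext.mk₀_comp_mk₀] at hx₂
    rw [← (Abelian.Ext.mk₀_bijective _ _).1 hx₂]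
    ext x
    -- A map on `N` that extends to `A` sends `x` to `x • h 1`, which vanishes.
    have h1 : h.hom (x.1 • (1 : A)) = x.1 • h.hom (1 : A) := h.hom.map_smul _ _
    rw [hNM _ (RingHom.mem_ker.1 x.2), smul_eq_mul, mul_one] at h1
    exact h1
  -- Surjectivity serves only to make `Ext¹` finite-dimensional: `finrank` would be `0` otherwise.
  have hsurj : Function.Surjective Φ := by
    intro x
    have : Projective S.X₂ := inferInstanceAs (Projective (ModuleCat.of A A))
    obtain ⟨x₁, hx₁⟩ := Abelian.Ext.contravariant_sequence_exact₃ hS M x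
      (Abelian.Ext.eq_zero_of_projective _) (add_zero 1)
    obtain ⟨h, rfl⟩ := (Abelian.Ext.mk₀_bijective _ _).2 x₁
    exact ⟨h, hx₁⟩
  have : Module.Finite F M := by
    let gF : A →ₗ[F] M :=
      { toFun := g
        map_add' := map_add g
        map_smul' := fun c a => by
          change g (c • a) = algebraMap F A c • g a
          rw [← map_smul, Algebra.smul_def, smul_eq_mul] }
    exact Module.Finite.of_surjective gF (e.symm.surjective.comp (Submodule.mkQ_surjective N))
  have : Module.Finite F (ModuleCat.of A N) := by
    let j : (ModuleCat.of A N) →ₗ[F] A :=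
      { toFun := N.subtype
        map_add' := map_add _
        map_smul' := fun _ _ => rfl }
    exact Module.Finite.of_injective j (Submodule.injective_subtype N)
  have : Module.Finite F (ModuleCat.of A N ⟶ M) := by
    let j : (ModuleCat.of A N ⟶ M) →ₗ[F] ((ModuleCat.of A N) →ₗ[F] M) :=
      { toFun := fun f => f.hom.restrictScalars F
        map_add' := fun _ _ => rfl
        map_smul' := fun _ _ => rfl }
    refine Module.Finite.of_injective j fun f f' h => ?_
    ext x
    exact LinearMap.congr_fun h x
  have : Module.Finite F (Abelian.Ext M M 1) := Module.Finite.of_surjective Φ hsurj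
  let f : ι → (ModuleCat.of A N ⟶ M) := fun i =>
    ModuleCat.ofHom (augmentationIdealHom ε (φ i) (hφ i) m fun x hx => hNM x hx m)
  have hf : LinearIndependent F f := by
    rw [Fintype.linearIndependent_iff]
    intro c hc j
    have h1 : ∀ z : N, ∀ t : Finset ι,
        (∑ i ∈ t, c i • f i).hom z = algebraMap F A (∑ i ∈ t, c i * φ i z) • m := by
      intro z t
      induction t using Finset.induction_on with
      | empty => simp
      | insert i t hi ih =>
        rw [Finset.sum_insert hi, Finset.sum_insert hi, map_add, add_smul, ← ih, map_mul, mul_smul]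
        rfl
    have h2 := h1 ⟨y j, RingHom.mem_ker.2 (hy j)⟩ Finset.univ
    rw [hc] at h2
    have h3 := hm _ h2.symm
    simpa [hφy] using h3
  exact (hf.map' Φ hinj).fintype_card_le_finrank

theorem exists_unique_vertex_of_augmentation [Module.Finite F A] (ε : A →ₐ[F] F)
    (hnil : ∀ x, ε x = 0 → IsNilpotent x)
    {ι : Type*} [Fintype ι] [DecidableEq ι] (φ : ι → A →ₗ[F] F)
    (hφ : ∀ i x y, ε x = 0 → ε y = 0 → φ i (x * y) = 0) (y : ι → A) (hy : ∀ i, ε (y i) = 0)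
    (hφy : ∀ i j, φ i (y j) = if i = j then 1 else 0) :
    ∃ v : ExtQuiver F A, (∀ w : ExtQuiver F A, w = v) ∧ Fintype.card ι ≤ Nat.card (v ⟶ v) := by
  have : Nontrivial A := ε.toRingHom.domain_nontrivial
  obtain ⟨I, hI⟩ := Ideal.exists_maximal A
  obtain rfl := ker_augmentation_le_of_isMaximal ε hnil I hI
  have hsimple : IsSimpleModule A (A ⧸ (RingHom.ker ε : Ideal A)) :=
    isSimpleModule_iff_quot_maximal.2 ⟨_, hI, ⟨LinearEquiv.refl A _⟩⟩
  refine ⟨Quotient.mk (simpleModSetoid A)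
    ⟨ModuleCat.of A (A ⧸ (RingHom.ker ε : Ideal A)), hsimple⟩, ?_, ?_⟩
  · intro w
    induction w using Quotient.inductionOn with
    | h M =>
      have := M.2
      obtain ⟨e⟩ := nonempty_linearEquiv_quotient_ker ε hnil M.1
      exact Quotient.sound ⟨e.toModuleIso⟩
  -- The module attached to a vertex is a chosen representative, so only its simplicity is used.
  · generalize Quotient.mk (simpleModSetoid A)
      ⟨ModuleCat.of A (A ⧸ (RingHom.ker ε : Ideal A)), hsimple⟩ = v
    change ExtQuiver F A at v
    have : IsSimpleModule A (ExtQuiver.simpleModule v) :=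
      (Quotient.out (s := simpleModSetoid A) v).2
    obtain ⟨e⟩ := nonempty_linearEquiv_quotient_ker ε hnil (ExtQuiver.simpleModule v)
    change _ ≤ Nat.card (Fin _)
    rw [Nat.card_fin]
    exact card_le_finrank_ext_one ε φ hφ y hy hφy _ e

end LocalAlgebra

/-! ### Algebras with a strictly triangular basis indexed by subsets -/

section TriangularBasis

variable {F : Type u} [Field F] {ι : Type*}

section Basis

variable {A : Type u} [Ring A] [Algebra F A] (b : Module.Basis (Finset ι) F A)

theorem repr_eq_zero_of_mem_span_image {s : Set (Finset ι)} {a : A}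
    (ha : a ∈ Submodule.span F (b '' s)) {J : Finset ι} (hJ : J ∉ s) : b.repr a J = 0 := by
  by_contra h
  exact hJ (b.mem_span_image.1 ha (Finsupp.mem_support_iff.2 h))

theorem mem_span_image_of_repr_eq_zero {s : Set (Finset ι)} {a : A}
    (h : ∀ J ∉ s, b.repr a J = 0) : a ∈ Submodule.span F (b '' s) := by
  refine b.mem_span_image.2 fun J hJ => ?_
  by_contra hs
  exact Finsupp.mem_support_iff.1 hJ (h J hs)

variable [Fintype ι] [DecidableEq ι] (hone : b Finset.univ = 1)
  (hmul : ∀ J K, J ≠ Finset.univ → b J * b K ∈ Submodule.span F (b '' {L | L ⊂ K}))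

include hone hmul in
-- By bilinearity it suffices to test basis vectors. For `J ≠ univ` every term of `b J * b K` is
-- indexed by a proper subset of `K`, hence never by `univ`.
theorem repr_univ_mul (x y : A) :
    b.repr (x * y) Finset.univ = b.repr x Finset.univ * b.repr y Finset.univ := by
  have : (LinearMap.mul F A).compr₂ (b.coord Finset.univ) =
      (LinearMap.mul F F).compl₁₂ (b.coord Finset.univ) (b.coord Finset.univ) := by
    refine b.ext fun J => b.ext fun K => ?_
    simp only [LinearMap.compr₂_apply, LinearMap.mul_apply', Module.Basis.coord_apply,
      LinearMap.compl₁₂_apply, Module.Basis.repr_self]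
    by_cases hJ : J = Finset.univ
    · subst hJ
      simp [hone]
    · rw [repr_eq_zero_of_mem_span_image b (hmul J K hJ)
        fun h : Finset.univ ⊂ K => h.2 (Finset.subset_univ K), Finsupp.single_eq_of_ne (Ne.symm hJ),
        zero_mul]
  exact LinearMap.congr_fun (LinearMap.congr_fun this x) y

/-- The coordinate of the unit basis vector, as an augmentation. -/
noncomputable def coordUnivAlgHom : A →ₐ[F] F :=
  AlgHom.ofLinearMap (b.coord Finset.univ)
    (by rw [← hone, Module.Basis.coord_apply, Module.Basis.repr_self, Finsupp.single_eq_same])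
    (repr_univ_mul b hone hmul)

include hmul in
-- Left multiplication by the augmentation ideal strictly lowers supports. Free `s` and `t` let it
-- serve both the nilpotency and the description of products of two elements of the ideal.
theorem mul_mem_span_lower {x : A} (hx : b.repr x Finset.univ = 0) (s t : Set (Finset ι))
    (hst : ∀ K ∈ s, ∀ L, L ⊂ K → L ∈ t) {y : A} (hy : y ∈ Submodule.span F (b '' s)) :
    x * y ∈ Submodule.span F (b '' t) := by
  induction hy using Submodule.span_induction with
  | mem y hy =>
    obtain ⟨K, hK, rfl⟩ := hy
    rw [← b.sum_repr x, Finset.sum_mul]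
    refine Submodule.sum_mem _ fun J _ => ?_
    by_cases hJ : J = Finset.univ
    · simp [hJ, hx]
    · rw [smul_mul_assoc]
      exact Submodule.smul_mem _ _ (Submodule.span_mono (Set.image_mono (hst K hK)) (hmul J K hJ))
  | zero => simp
  | add y z _ _ hy hz => rw [mul_add]; exact add_mem hy hz
  | smul c y _ hy => rw [mul_smul_comm]; exact Submodule.smul_mem _ _ hy

include hmul in
theorem isNilpotent_of_repr_univ_eq_zero {x : A} (hx : b.repr x Finset.univ = 0) :
    IsNilpotent x := by
  have key : ∀ m, x ^ m ∈ Submodule.span F (b '' {L | L.card + m ≤ Fintype.card ι}) := by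
    intro m
    induction m with
    | zero =>
      exact mem_span_image_of_repr_eq_zero b fun J hJ => absurd (Finset.card_le_univ J) hJ
    | succ m ih =>
      rw [pow_succ']
      refine mul_mem_span_lower b hmul hx _ _ (fun K hK L hL => ?_) ih
      have h1 : K.card + m ≤ Fintype.card ι := hK
      have h2 := Finset.card_lt_card hL
      change L.card + (m + 1) ≤ _
      omega
  -- Each factor costs at least one element of the support sets, so after this many no set is left.
  refine ⟨Fintype.card ι + 1, ?_⟩
  have h := key (Fintype.card ι + 1)
  have : {L : Finset ι | L.card + (Fintype.card ι + 1) ≤ Fintype.card ι} = ∅ := by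
    ext L
    simp only [Set.mem_ofPred_eq, Set.mem_empty_iff_false, iff_false]
    omega
  rwa [this, Set.image_empty, Submodule.span_empty, Submodule.mem_bot] at h

include hone hmul in
-- A product of two elements of the augmentation ideal is supported on `L ⊂ K ⊂ univ`, so its
-- coordinates at the sets of corank one vanish. These coordinates are the required functionals.
theorem exists_unique_vertex_of_triangular_basis :
    ∃ v : ExtQuiver F A, (∀ w : ExtQuiver F A, w = v) ∧ Fintype.card ι ≤ Nat.card (v ⟶ v) := by
  have : Module.Finite F A := Module.Finite.of_basis b
  have herase : ∀ i : ι, Finset.univ.erase i ≠ Finset.univ := fun i h =>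
    (Finset.ext_iff.1 h i).not.1 (Finset.notMem_erase i _) (Finset.mem_univ i)
  refine exists_unique_vertex_of_augmentation (coordUnivAlgHom b hone hmul)
    (fun x hx => isNilpotent_of_repr_univ_eq_zero b hmul hx)
    (fun i => b.coord (Finset.univ.erase i)) (fun i x y hx hy => ?_)
    (fun i => b (Finset.univ.erase i)) (fun i => ?_) (fun i j => ?_)
  · have hy' : y ∈ Submodule.span F (b '' {L | L ≠ Finset.univ}) :=
      mem_span_image_of_repr_eq_zero b fun J hJ => by
        rw [not_not.1 hJ]
        exact hy
    refine repr_eq_zero_of_mem_span_image b (mul_mem_span_lower b hmul hx _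
      {L | ∃ K, K ≠ Finset.univ ∧ L ⊂ K} (fun K hK L hL => ⟨K, hK, hL⟩) hy') ?_
    rintro ⟨K, hK, hL⟩
    have h1 := Finset.card_lt_card hL
    have h2 := Finset.card_lt_card (Finset.ssubset_univ_iff.2 hK)
    rw [Finset.card_erase_of_mem (Finset.mem_univ i)] at h1
    omega
  · change b.repr _ _ = 0
    rw [Module.Basis.repr_self, Finsupp.single_eq_of_ne (Ne.symm (herase i))]
  · rw [Module.Basis.coord_apply, Module.Basis.repr_self, Finsupp.single_apply]
    refine if_congr ?_ rfl rfl
    rw [Finset.erase_inj _ (Finset.mem_univ j)]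
    exact eq_comm

end Basis

/-- Triangularity and `x univ = 1` make the linear span closed under products, so it is the
generated algebra and the `x J` are a basis of it. -/
theorem exists_unique_vertex_of_adjoin_triangular [Fintype ι] [DecidableEq ι] {B : Type u} [Ring B] [Algebra F B]
    (x : Finset ι → B) (hx : LinearIndependent F x) (hone : x Finset.univ = 1)
    (hmul : ∀ J K, J ≠ Finset.univ → x J * x K ∈ Submodule.span F (x '' {L | L ⊂ K}))
    (A : Subalgebra F B) (hA : A = Algebra.adjoin F (Set.range x)) :
    ∃ v : ExtQuiver F A, (∀ w : ExtQuiver F A, w = v) ∧ Fintype.card ι ≤ Nat.card (v ⟶ v) := by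
  have hmem : ∀ J, x J ∈ A := fun J => hA ▸ Algebra.subset_adjoin ⟨J, rfl⟩
  have hclosed : ∀ y ∈ Submodule.span F (Set.range x), ∀ z ∈ Submodule.span F (Set.range x),
      y * z ∈ Submodule.span F (Set.range x) := by
    intro y hy z hz
    have hle : Submodule.span F (Set.range x) * Submodule.span F (Set.range x) ≤
        Submodule.span F (Set.range x) := by
      rw [Submodule.span_mul_span, Submodule.span_le]
      rintro _ ⟨_, ⟨J, rfl⟩, _, ⟨K, rfl⟩, rfl⟩
      by_cases hJ : J = Finset.univ
      · simpa [hJ, hone] using Submodule.subset_span (Set.mem_range_self K)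
      · exact Submodule.span_mono (Set.image_subset_range _ _) (hmul J K hJ)
    exact hle (Submodule.mul_mem_mul hy hz)
  have hspan : ∀ a ∈ A, a ∈ Submodule.span F (Set.range x) := by
    intro a ha
    rw [hA] at ha
    induction ha using Algebra.adjoin_induction with
    | mem a ha => exact Submodule.subset_span ha
    | algebraMap c =>
      rw [Algebra.algebraMap_eq_smul_one, ← hone]
      exact Submodule.smul_mem _ _ (Submodule.subset_span ⟨_, rfl⟩)
    | add a a' _ _ h h' => exact add_mem h h'
    | mul a a' _ _ h h' => exact hclosed _ h _ h'
  let x' : Finset ι → A := fun J => ⟨x J, hmem J⟩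
  have himage : ∀ (s : Set (Finset ι)) (a : A),
      (a : B) ∈ Submodule.span F (x '' s) ↔ a ∈ Submodule.span F (x' '' s) := by
    intro s a
    have : x '' s = A.val.toLinearMap '' (x' '' s) := by
      rw [Set.image_image]
      rfl
    rw [this, Submodule.span_image]
    exact ⟨fun ⟨c, hc, h⟩ => Subtype.val_injective h ▸ hc, fun h => ⟨a, h, rfl⟩⟩
  have hx' : LinearIndependent F x' := LinearIndependent.of_comp A.val.toLinearMap hx
  let b : Module.Basis (Finset ι) F A := Module.Basis.mk hx' fun a _ => by
    have := hspan a a.2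
    rw [← Set.image_univ] at this ⊢
    exact (himage _ a).1 this
  have hb : ⇑b = x' := Module.Basis.coe_mk _ _
  refine exists_unique_vertex_of_triangular_basis b ?_ fun J K hJ => ?_
  · rw [hb]
    exact Subtype.ext hone
  · rw [hb]
    exact (himage _ _).1 (hmul J K hJ)

end TriangularBasis

/-! ### Face monoids and the structure constants of the descent algebra -/

section FaceMonoid

/-- A finite group `W` acting on a finite monoid `M` of faces, with one representative `φ J` of
each orbit, the base chamber `φ ∅`, the distinguished subsets `X J`, and an element `z` of `W`
that acts on the faces as the antipode. -/
structure IsFaceSystem (W : Type*) [Group W] {M : Type*} [Monoid M] [MulDistribMulAction W M]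
    {ι : Type*} [Fintype ι] (φ : Finset ι → M) (X : Finset ι → Set W) (z : W) : Prop where
  mul_self : ∀ f : M, f * f = f
  free : ∀ w : W, w • φ ∅ = φ ∅ → w = 1
  mul_chamber : ∀ f : M, ∃ w : W, f * φ ∅ = w • φ ∅
  dominant : ∀ f : M, f * φ ∅ = φ ∅ → ∃ J, f = φ J
  rep_mul_chamber : ∀ J, φ J * φ ∅ = φ ∅
  rep_injective : ∀ (w : W) (J K), w • φ J = φ K → J = K
  mem_iff : ∀ (w : W) (J), w ∈ X J ↔ (w • φ J) * φ ∅ = w • φ ∅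
  left_mul_chamber : ∀ g f : M, (g * f) * φ ∅ = φ ∅ → g * φ ∅ = φ ∅
  subset_of_rep_mul : ∀ (K L) (f : M), φ K * f = φ L → L ⊆ K
  rep_univ : φ Finset.univ = 1
  antipode_antipode : z * z = 1
  eq_one_of_antipode : ∀ f : M, z • f = f → f = 1
  mul_antipode : ∀ g f : M, g * f = g → g * (z • f) = g
  exists_descents : ∀ D : Finset ι, ∃ w : W, ∀ J, w ∈ X J ↔ Disjoint D J

variable {W : Type*} [Group W] (F : Type u) [Field F]

/-- The sum, in the group algebra, of the elements of a set. -/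
noncomputable def setSum [Finite W] (X : Set W) : MonoidAlgebra F W :=
  ∑ w ∈ (Set.toFinite X).toFinset, MonoidAlgebra.of F W w

theorem setSum_coeff [Finite W] (X : Set W) [DecidablePred (· ∈ X)] (w : W) :
    (setSum F X).coeff w = if w ∈ X then 1 else 0 := by
  classical
  simp [setSum, MonoidAlgebra.coeff_sum, Finsupp.single_apply]

namespace IsFaceSystem

variable {F} {M : Type*} [Monoid M] [MulDistribMulAction W M] {ι : Type*} {φ : Finset ι → M}

section Faces

variable [Finite M] (W φ)

/-- The faces of type `J`. -/
noncomputable def faces (J : Finset ι) : Finset M :=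
  (Set.toFinite (MulAction.orbit W (φ J))).toFinset

variable {W φ}

theorem mem_faces {J : Finset ι} {f : M} : f ∈ faces W φ J ↔ ∃ w : W, w • φ J = f := by
  rw [faces, Set.Finite.mem_toFinset, MulAction.mem_orbit_iff]

theorem smul_mem_faces {J : Finset ι} {f : M} (w : W) (hf : f ∈ faces W φ J) :
    w • f ∈ faces W φ J := by
  obtain ⟨v, rfl⟩ := mem_faces.1 hf
  exact mem_faces.2 ⟨w * v, mul_smul _ _ _⟩

theorem smul_mem_faces_iff {J : Finset ι} {f : M} (w : W) :
    w • f ∈ faces W φ J ↔ f ∈ faces W φ J :=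
  ⟨fun hf => by simpa using smul_mem_faces w⁻¹ hf, smul_mem_faces w⟩

variable (W φ) in
/-- The factorisations of the face `e` as a product of a face of type `K` and one of type `J`. -/
noncomputable def factorizations (J K : Finset ι) (e : M) : Finset (M × M) :=
  open Classical in {p ∈ faces W φ J ×ˢ faces W φ K | p.2 * p.1 = e}

theorem mem_factorizations {J K : Finset ι} {e : M} {p : M × M} :
    p ∈ factorizations W φ J K e ↔
      p.1 ∈ faces W φ J ∧ p.2 ∈ faces W φ K ∧ p.2 * p.1 = e := by
  simp only [factorizations, Finset.mem_filter, Finset.mem_product, and_assoc]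

theorem card_factorizations_smul (J K : Finset ι) (w : W) (e : M) :
    (factorizations W φ J K (w • e)).card = (factorizations W φ J K e).card := by
  refine (Finset.card_nbij (fun p => (w • p.1, w • p.2)) (fun p hp => ?_) ?_ (fun p hp => ?_)).symm
  · rw [Finset.mem_coe, mem_factorizations] at hp ⊢
    rw [smul_mem_faces_iff, smul_mem_faces_iff, ← smul_mul', hp.2.2]
    exact ⟨hp.1, hp.2.1, rfl⟩
  · intro p _ q _ hpq
    rw [Prod.mk.injEq, smul_left_cancel_iff, smul_left_cancel_iff] at hpq
    exact Prod.ext hpq.1 hpq.2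
  · refine ⟨(w⁻¹ • p.1, w⁻¹ • p.2), ?_, Prod.ext (smul_inv_smul _ _) (smul_inv_smul _ _)⟩
    rw [Finset.mem_coe, mem_factorizations] at hp ⊢
    rw [smul_mem_faces_iff, smul_mem_faces_iff, ← smul_mul', hp.2.2, inv_smul_smul]
    exact ⟨hp.1, hp.2.1, rfl⟩

end Faces

variable [Fintype ι] {X : Finset ι → Set W} {z : W} (h : IsFaceSystem W φ X z)

/-- The element of `W` whose chamber is the projection of the base chamber to the face `f`. -/
noncomputable def proj (f : M) : W := (h.mul_chamber f).choose

theorem proj_spec (f : M) : f * φ ∅ = h.proj f • φ ∅ := (h.mul_chamber f).choose_spec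

theorem proj_eq {f : M} {w : W} (hw : f * φ ∅ = w • φ ∅) : h.proj f = w := by
  rw [h.proj_spec] at hw
  have := h.free (w⁻¹ * h.proj f) (by rw [mul_smul, hw, inv_smul_smul])
  rwa [inv_mul_eq_one, eq_comm] at this

/-- Translating `f` back by `proj f` gives a face whose projection of the base chamber is the base
chamber itself, so `dominant` applies. -/
theorem exists_rep (f : M) : ∃ J, f = h.proj f • φ J := by
  obtain ⟨J, hJ⟩ := h.dominant ((h.proj f)⁻¹ • f) (by
    rw [← smul_left_cancel_iff (h.proj f), smul_mul', smul_inv_smul, ← h.proj_spec, ← mul_assoc, h.mul_self])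
  exact ⟨J, by rw [← hJ, smul_inv_smul]⟩

include h in
theorem eq_of_smul_eq_smul {v w : W} {J K : Finset ι} (e : v • φ J = w • φ K) : J = K :=
  h.rep_injective (w⁻¹ * v) J K (by rw [mul_smul, e, inv_smul_smul])

include h in
theorem X_univ : X Finset.univ = {1} := by
  ext w
  rw [h.mem_iff, h.rep_univ, smul_one, one_mul, Set.mem_singleton_iff]
  exact ⟨fun e => h.free w e.symm, fun e => by rw [e, one_smul]⟩

/-- Apply `proj f` to `g * φ ∅ = proj g • φ ∅`. The group product thus becomes the face product in
reverse order, with one factor twisted. -/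
theorem mul_proj (f g : M) : h.proj f * h.proj g = h.proj ((h.proj f • g) * f) := by
  refine (h.proj_eq ?_).symm
  rw [mul_assoc, h.proj_spec, ← smul_mul', h.proj_spec g, mul_smul]

include h in
-- Since `g * f` fixes the base chamber, so does `g`; hence `g` is one of the representatives, and
-- its orbit determines which.
theorem subset_of_mul_eq {f g : M} {w : W} {K L : Finset ι} (hg : g = w • φ K)
    (e : g * f = φ L) : g = φ K ∧ L ⊆ K := by
  obtain ⟨K', hK'⟩ := h.dominant g (h.left_mul_chamber g f (by rw [e, h.rep_mul_chamber]))
  obtain rfl : K = K' := h.rep_injective w K K' (hg ▸ hK')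
  exact ⟨hK', h.subset_of_rep_mul K L f (hK' ▸ e)⟩

include h in
-- The antipode on the first factor is an involution of the factorisations of `φ K`. A fixed point
-- would have first factor `1`, which has type `univ`.
theorem card_factorizations_self [Finite M] [CharP F 2] {J K : Finset ι} (hJ : J ≠ Finset.univ) :
    ((factorizations W φ J K (φ K)).card : F) = 0 := by
  rw [Finset.card_eq_sum_ones, Nat.cast_sum]
  refine Finset.sum_involution (fun p _ => (z • p.1, p.2)) (fun p _ => ?_) (fun p hp _ e => ?_)
    (fun p hp => ?_) (fun p _ => ?_)
  · rw [Nat.cast_one]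
    exact CharTwo.add_self_eq_zero 1
  · obtain ⟨w, hw⟩ := mem_faces.1 (mem_factorizations.1 hp).1
    have h1 := h.eq_one_of_antipode p.1 (congrArg Prod.fst e)
    refine hJ (h.eq_of_smul_eq_smul (v := w) (w := 1) ?_)
    rw [hw, h1, h.rep_univ, one_smul]
  · obtain ⟨h1, h2, h3⟩ := mem_factorizations.1 hp
    obtain ⟨w, hw⟩ := mem_faces.1 h2
    have h4 := (h.subset_of_mul_eq hw.symm h3).1
    refine mem_factorizations.2 ⟨smul_mem_faces _ h1, h2, ?_⟩
    have h5 := h.mul_antipode p.2 p.1 (h3.trans h4.symm)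
    exact h5.trans h4
  · exact Prod.ext (by rw [smul_smul, h.antipode_antipode, one_smul]) rfl

include h in
-- The coefficient of a relation at an element with descent set `Eᶜ` is the sum of the `c J` over `J
-- ⊆ E`; Möbius inversion on subsets then gives `c = 0`.
theorem linearIndependent_setSum [Finite W] : LinearIndependent F (fun J => setSum F (X J)) := by
  classical
  rw [Fintype.linearIndependent_iff]
  intro c hc
  have key : ∀ E : Finset ι, ∑ J ∈ E.powerset, c J = 0 := by
    intro E
    obtain ⟨w, hw⟩ := h.exists_descents Eᶜ
    have := congrArg (fun a => MonoidAlgebra.coeff a w) hc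
    simp only [MonoidAlgebra.coeff_sum, Finsupp.coe_finsetSum, Finset.sum_apply,
      MonoidAlgebra.coeff_smul, Finsupp.smul_apply, setSum_coeff, smul_eq_mul, mul_ite, mul_one,
      mul_zero, MonoidAlgebra.coeff_zero, Finsupp.coe_zero, Pi.zero_apply] at this
    rw [← Finset.sum_filter] at this
    rw [← this]
    refine Finset.sum_congr ?_ fun _ _ => rfl
    ext J
    rw [Finset.mem_powerset, Finset.mem_filter, hw, disjoint_comm,
      ← Finset.subset_compl_iff_disjoint_right, compl_compl]
    simp
  intro J
  induction J using Finset.strongInduction with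
  | H J ih =>
    have := key J
    rwa [← Finset.insert_erase (Finset.mem_powerset_self J),
      Finset.sum_insert (Finset.notMem_erase _ _), Finset.sum_eq_zero, add_zero] at this
    intro K hK
    rw [Finset.mem_erase, Finset.mem_powerset] at hK
    exact ih K (hK.2.ssubset_of_ne hK.1)

include h in
theorem setSum_X_univ [Finite W] : setSum F (X Finset.univ) = 1 := by
  have : (Set.toFinite (X Finset.univ)).toFinset = {1} := by
    ext w
    rw [Set.Finite.mem_toFinset, h.X_univ, Set.mem_singleton_iff, Finset.mem_singleton]
  rw [setSum, this, Finset.sum_singleton, map_one]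

section Faces

variable [Finite M] [Finite W]

/-- The map `w ↦ w • φ J` is a bijection from `X J` to the faces of type `J`, with inverse `proj`.
-/
theorem setSum_X (J : Finset ι) :
    setSum F (X J) = ∑ f ∈ faces W φ J, MonoidAlgebra.of F W (h.proj f) := by
  have hproj : ∀ w ∈ X J, h.proj (w • φ J) = w := fun w hw => h.proj_eq ((h.mem_iff w J).1 hw)
  refine Finset.sum_nbij (fun w => w • φ J) (fun w _ => mem_faces.2 ⟨w, rfl⟩) ?_ ?_ ?_
  · intro v hv w hw e
    rw [Set.Finite.coe_toFinset] at hv hw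
    rw [← hproj v hv, ← hproj w hw]
    exact congrArg _ e
  · intro f hf
    obtain ⟨w, rfl⟩ := mem_faces.1 hf
    obtain ⟨K, hK⟩ := h.exists_rep (w • φ J)
    obtain rfl := h.eq_of_smul_eq_smul hK
    refine ⟨h.proj (w • φ J), ?_, hK.symm⟩
    rw [Set.Finite.coe_toFinset, h.mem_iff, ← hK, h.proj_spec]
  · intro w hw
    rw [Set.Finite.mem_toFinset] at hw
    rw [hproj w hw]

theorem setSum_mul_setSum (J K : Finset ι) :
    setSum F (X J) * setSum F (X K) =
      ∑ p ∈ faces W φ J ×ˢ faces W φ K, MonoidAlgebra.of F W (h.proj (p.2 * p.1)) := by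
  rw [h.setSum_X, h.setSum_X, Finset.sum_mul, Finset.sum_product]
  refine Finset.sum_congr rfl fun f _ => ?_
  rw [Finset.mul_sum]
  -- For fixed `f`, translation by `proj f` permutes the faces of type `K` and absorbs the twist in
  -- `mul_proj`.
  refine Finset.sum_nbij (fun g => h.proj f • g) (fun g hg => smul_mem_faces _ hg)
    (MulAction.injective (h.proj f)).injOn (fun g hg => ?_) (fun g _ => ?_)
  · exact ⟨(h.proj f)⁻¹ • g, smul_mem_faces _ hg, smul_inv_smul _ _⟩
  · rw [← map_mul, h.mul_proj]

include h in
-- Group the pairs by their product face. The number of factorisations is constant on orbits, so it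
-- can be taken at the representative of each type.
theorem setSum_mul_setSum_eq_sum (J K : Finset ι) :
    setSum F (X J) * setSum F (X K) =
      ∑ L, (factorizations W φ J K (φ L)).card • setSum F (X L) := by
  classical
  have := Fintype.ofFinite M
  choose t ht using h.exists_rep
  rw [h.setSum_mul_setSum, ← Finset.sum_fiberwise _ (fun p => p.2 * p.1),
    ← Finset.sum_fiberwise _ t]
  refine Finset.sum_congr rfl fun L _ => ?_
  rw [h.setSum_X, Finset.smul_sum]
  refine Finset.sum_congr ?_ fun e he => ?_
  · ext e
    rw [Finset.mem_filter, mem_faces]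
    constructor
    · rintro ⟨_, rfl⟩
      exact ⟨_, (ht e).symm⟩
    · rintro ⟨w, rfl⟩
      exact ⟨Finset.mem_univ _, (h.eq_of_smul_eq_smul (ht (w • φ L))).symm⟩
  · obtain ⟨w, rfl⟩ := mem_faces.1 he
    rw [← card_factorizations_smul J K w, ← Finset.sum_const]
    refine Finset.sum_congr ?_ fun p hp => ?_
    · ext p
      rw [Finset.mem_filter, mem_factorizations, Finset.mem_product, and_assoc]
    · rw [(mem_factorizations.1 hp).2.2]

include h in
theorem setSum_mul_mem_span [CharP F 2] (J K : Finset ι) (hJ : J ≠ Finset.univ) :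
    setSum F (X J) * setSum F (X K) ∈
      Submodule.span F ((fun L => setSum F (X L)) '' {L | L ⊂ K}) := by
  rw [h.setSum_mul_setSum_eq_sum]
  refine Submodule.sum_mem _ fun L _ => ?_
  by_cases hc : (factorizations W φ J K (φ L)).card = 0
  · rw [hc, zero_smul]
    exact Submodule.zero_mem _
  obtain ⟨p, hp⟩ := Finset.card_pos.1 (Nat.pos_of_ne_zero hc)
  obtain ⟨_, h2, h3⟩ := mem_factorizations.1 hp
  obtain ⟨w, hw⟩ := mem_faces.1 h2
  rcases (h.subset_of_mul_eq hw.symm h3).2.eq_or_ssubset with rfl | hL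
  · rw [← Nat.cast_smul_eq_nsmul F, h.card_factorizations_self hJ, zero_smul]
    exact Submodule.zero_mem _
  · exact Submodule.smul_of_tower_mem _ _ (Submodule.subset_span ⟨L, hL, rfl⟩)

end Faces

end IsFaceSystem

end FaceMonoid

/-! ### Signed permutations, roots and dominance in type `D` -/

section TypeDCombinatorics

/-- The lower end of the pair of adjacent entries exchanged by the `k`-th generator. -/
def typeDLow (k : ℕ) : ℤ := if k = 0 then -2 else k

/-- The upper end of the pair of adjacent entries exchanged by the `k`-th generator. -/
def typeDHigh (k : ℕ) : ℤ := if k = 0 then 1 else k + 1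

/-- The `k`-th generator: `u` for `k = 0`, and `t_k` otherwise. -/
def typeDPerm (k : ℕ) : Equiv.Perm ℤ := if k = 0 then typeDFork else typeDSimple k

/-- The pair `(i, j)` indexes the root `e_j - e_i`, where `e_{-i} = -e_i`. -/
def IsTypeDRoot (n : ℕ) (i j : ℤ) : Prop :=
  i ≠ 0 ∧ -n ≤ i ∧ i ≤ n ∧ j ≠ 0 ∧ -n ≤ j ∧ j ≤ n ∧ i ≠ j ∧ i ≠ -j

theorem IsTypeDRoot.symm {n : ℕ} {i j : ℤ} (h : IsTypeDRoot n i j) : IsTypeDRoot n j i := by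
  unfold IsTypeDRoot at *
  omega

theorem typeDPerm_apply (k : ℕ) (x : ℤ) :
    typeDPerm k x =
      if x = typeDLow k then typeDHigh k else if x = typeDHigh k then typeDLow k else
      if x = -typeDLow k then -typeDHigh k else if x = -typeDHigh k then -typeDLow k else x := by
  unfold typeDPerm typeDLow typeDHigh
  by_cases hk : k = 0
  · simp only [hk, if_true, typeDFork, Equiv.Perm.mul_apply, Equiv.swap_apply_def]
    split_ifs <;> first | contradiction | omega
  · simp only [hk, if_false, typeDSimple, Equiv.Perm.mul_apply, Equiv.swap_apply_def]
    split_ifs <;> first | contradiction | omega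

theorem typeDLow_lt_typeDHigh (k : ℕ) : typeDLow k < typeDHigh k := by
  unfold typeDLow typeDHigh
  split_ifs <;> first | contradiction | omega

theorem isTypeDRoot_low_high {n k : ℕ} (hn : 2 ≤ n) (hk : k < n) :
    IsTypeDRoot n (typeDLow k) (typeDHigh k) := by
  unfold IsTypeDRoot typeDLow typeDHigh
  split_ifs <;> first | contradiction | omega

theorem typeDPerm_low (k : ℕ) : typeDPerm k (typeDLow k) = typeDHigh k := by
  rw [typeDPerm_apply, if_pos rfl]

theorem typeDPerm_high (k : ℕ) : typeDPerm k (typeDHigh k) = typeDLow k := by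
  rw [typeDPerm_apply, if_neg (typeDLow_lt_typeDHigh k).ne', if_pos rfl]

theorem typeDPerm_typeDPerm (k : ℕ) (x : ℤ) : typeDPerm k (typeDPerm k x) = x := by
  rw [typeDPerm_apply, typeDPerm_apply]
  unfold typeDLow typeDHigh
  split_ifs <;> first | contradiction | omega

theorem typeDPerm_odd (k : ℕ) : Function.Odd (typeDPerm k) := by
  intro x
  rw [typeDPerm_apply, typeDPerm_apply]
  unfold typeDLow typeDHigh
  split_ifs <;> first | contradiction | omega

theorem typeDPerm_fixes {n k : ℕ} (hn : 2 ≤ n) (hk : k < n) (x : ℤ)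
    (hx : ¬ (-n ≤ x ∧ x ≤ n)) : typeDPerm k x = x := by
  rw [typeDPerm_apply]
  unfold typeDLow typeDHigh
  split_ifs <;> first | contradiction | omega

/-- A simple reflection permutes the positive roots other than its own, which appears as two index
pairs because `e_j - e_i` is also indexed by `(-j, -i)`. -/
theorem typeDPerm_lt_typeDPerm {n k : ℕ} {i j : ℤ} (hij : IsTypeDRoot n i j)
    (hlt : i < j) : typeDPerm k i < typeDPerm k j ∨
      (i = typeDLow k ∧ j = typeDHigh k) ∨ (i = -typeDHigh k ∧ j = -typeDLow k) := by
  rw [typeDPerm_apply, typeDPerm_apply]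
  unfold IsTypeDRoot typeDLow typeDHigh at *
  split_ifs <;> first | contradiction | omega

theorem mem_typeDGenerators {n : ℕ} (hn : 2 ≤ n) {σ : Equiv.Perm ℤ} :
    σ ∈ typeDGenerators n ↔ ∃ k < n, σ = typeDPerm k := by
  constructor
  · rintro (rfl | ⟨i, h1, h2, rfl⟩)
    · exact ⟨0, by omega, by rw [typeDPerm, if_pos rfl]⟩
    · exact ⟨i, h2, by rw [typeDPerm, if_neg (by omega)]⟩
  · rintro ⟨k, hk, rfl⟩
    by_cases h0 : k = 0
    · exact Or.inl (by rw [typeDPerm, if_pos h0])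
    · exact Or.inr ⟨k, by omega, hk, by rw [typeDPerm, if_neg h0]⟩

variable {n : ℕ}

theorem typeDPerm_mem (hn : 2 ≤ n) {k : ℕ} (hk : k < n) :
    typeDPerm k ∈ Subgroup.closure (typeDGenerators n) :=
  Subgroup.subset_closure ((mem_typeDGenerators hn).2 ⟨k, hk, rfl⟩)

theorem typeD_odd (hn : 2 ≤ n) {w : Equiv.Perm ℤ}
    (hw : w ∈ Subgroup.closure (typeDGenerators n)) : Function.Odd w := by
  induction hw using Subgroup.closure_induction with
  | mem σ h =>
    obtain ⟨k, _, rfl⟩ := (mem_typeDGenerators hn).1 h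
    exact typeDPerm_odd k
  | one => exact fun x => rfl
  | mul σ τ _ _ h1 h2 => exact fun x => by rw [Equiv.Perm.mul_apply, h2, h1, Equiv.Perm.mul_apply]
  | inv σ _ h => exact fun x => by rw [Equiv.Perm.inv_eq_iff_eq, h]; exact congrArg _ (Equiv.apply_symm_apply σ x).symm

theorem typeD_fixes_of_notMem (hn : 2 ≤ n) {w : Equiv.Perm ℤ}
    (hw : w ∈ Subgroup.closure (typeDGenerators n)) (x : ℤ) (hx : ¬ (-n ≤ x ∧ x ≤ n)) :
    w x = x := by
  induction hw using Subgroup.closure_induction with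
  | mem σ h =>
    obtain ⟨k, hk, rfl⟩ := (mem_typeDGenerators hn).1 h
    exact typeDPerm_fixes hn hk x hx
  | one => rfl
  | mul σ τ _ _ h1 h2 => rw [Equiv.Perm.mul_apply, h2, h1]
  | inv σ _ h => rw [Equiv.Perm.inv_eq_iff_eq, h]

theorem typeD_apply_mem (hn : 2 ≤ n) {w : Equiv.Perm ℤ}
    (hw : w ∈ Subgroup.closure (typeDGenerators n)) {x : ℤ} (hx : -n ≤ x ∧ x ≤ n) :
    -n ≤ w x ∧ w x ≤ n := by
  by_contra h
  have := typeD_fixes_of_notMem hn hw _ h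
  rw [w.injective this] at h
  exact h hx

theorem IsTypeDRoot.map (hn : 2 ≤ n) {w : Equiv.Perm ℤ}
    (hw : w ∈ Subgroup.closure (typeDGenerators n)) {i j : ℤ} (h : IsTypeDRoot n i j) :
    IsTypeDRoot n (w i) (w j) := by
  obtain ⟨h1, h2, h3, h4, h5, h6, h7, h8⟩ := h
  have h0 : w 0 = 0 := by
    have := typeD_odd hn hw 0
    rw [neg_zero] at this
    omega
  have hi := typeD_apply_mem hn hw ⟨h2, h3⟩
  have hj := typeD_apply_mem hn hw ⟨h5, h6⟩
  refine ⟨fun e => h1 (w.injective (e.trans h0.symm)), hi.1, hi.2,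
    fun e => h4 (w.injective (e.trans h0.symm)), hj.1, hj.2, fun e => h7 (w.injective e),
    fun e => h8 (w.injective ?_)⟩
  rw [e, typeD_odd hn hw]

/-! #### Evenness of the number of sign changes -/

theorem prod_sign_typeDPerm (hn : 2 ≤ n) {k : ℕ} (hk : k < n) {v : ℤ → ℤ} (hv : Function.Odd v) :
    ∏ i ∈ Finset.Icc (1 : ℤ) n, (v (typeDPerm k i)).sign =
      ∏ i ∈ Finset.Icc (1 : ℤ) n, (v i).sign := by
  have hpos : ∀ k < n, k ≠ 0 → ∏ i ∈ Finset.Icc (1 : ℤ) n, (v (typeDPerm k i)).sign =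
      ∏ i ∈ Finset.Icc (1 : ℤ) n, (v i).sign := by
    intro k hk h0
    have hmem : ∀ i ∈ Finset.Icc (1 : ℤ) n, typeDPerm k i ∈ Finset.Icc (1 : ℤ) n := by
      intro i hi
      rw [Finset.mem_Icc] at hi ⊢
      rw [typeDPerm_apply]
      unfold typeDLow typeDHigh
      split_ifs <;> first | contradiction | omega
    exact Finset.prod_nbij' (typeDPerm k) (typeDPerm k) hmem hmem
      (fun i _ => typeDPerm_typeDPerm k i) (fun i _ => typeDPerm_typeDPerm k i) (fun i _ => rfl)
  by_cases h0 : k = 0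
  · subst h0
    -- On positive indices `u` differs from `t_1` only by a sign at both `1` and `2`, and the two
    -- signs cancel.
    rw [← hpos 1 (by omega) one_ne_zero]
    have h : ∀ i ∈ Finset.Icc (1 : ℤ) n, (v (typeDPerm 0 i)).sign =
        (if i = 1 ∨ i = 2 then -1 else 1) * (v (typeDPerm 1 i)).sign := by
      intro i hi
      rw [Finset.mem_Icc] at hi
      by_cases h : i = 1 ∨ i = 2
      · have : typeDPerm 0 i = -typeDPerm 1 i := by
          rw [typeDPerm_apply, typeDPerm_apply]
          unfold typeDLow typeDHigh
          split_ifs <;> first | contradiction | omega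
        rw [if_pos h, this, hv, Int.sign_neg, neg_one_mul]
      · have : typeDPerm 0 i = typeDPerm 1 i := by
          rw [typeDPerm_apply, typeDPerm_apply]
          unfold typeDLow typeDHigh
          split_ifs <;> first | contradiction | omega
        rw [if_neg h, this, one_mul]
    have h2 : ∏ i ∈ Finset.Icc (1 : ℤ) n, (if i = 1 ∨ i = 2 then (-1 : ℤ) else 1) = 1 := by
      rw [← Finset.prod_subset (s₁ := {1, 2})]
      · simp
      · intro i hi
        rw [Finset.mem_insert, Finset.mem_singleton] at hi
        rw [Finset.mem_Icc]
        omega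
      · intro i _ hi
        rw [Finset.mem_insert, Finset.mem_singleton] at hi
        rw [if_neg hi]
    rw [Finset.prod_congr rfl h, Finset.prod_mul_distrib, h2, one_mul]
  · exact hpos k hk h0

theorem prod_sign_comp (hn : 2 ≤ n) {w : Equiv.Perm ℤ}
    (hw : w ∈ Subgroup.closure (typeDGenerators n)) :
    ∀ {v : ℤ → ℤ}, Function.Odd v → ∏ i ∈ Finset.Icc (1 : ℤ) n, (v (w i)).sign =
      ∏ i ∈ Finset.Icc (1 : ℤ) n, (v i).sign := by
  induction hw using Subgroup.closure_induction with
  | mem σ h =>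
    obtain ⟨k, hk, rfl⟩ := (mem_typeDGenerators hn).1 h
    exact fun hv => prod_sign_typeDPerm hn hk hv
  | one => exact fun _ => rfl
  | mul σ τ hσ _ h1 h2 =>
    intro v hv
    rw [← h1 hv]
    exact h2 (v := fun i => v (σ i)) fun x => by simp only [typeD_odd hn hσ x, hv (σ x)]
  | inv σ hσ h =>
    intro v hv
    rw [← h (v := fun i => v (σ⁻¹ i)) fun x => by
      simp only [typeD_odd hn (inv_mem hσ) x, hv (σ⁻¹ x)]]
    simp only [show ∀ i, σ⁻¹ (σ i) = i from Equiv.symm_apply_apply σ]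

theorem prod_sign_eq_one (hn : 2 ≤ n) {w : Equiv.Perm ℤ}
    (hw : w ∈ Subgroup.closure (typeDGenerators n)) :
    ∏ i ∈ Finset.Icc (1 : ℤ) n, (w i).sign = 1 := by
  rw [prod_sign_comp hn hw (v := fun i => i) fun _ => rfl]
  refine Finset.prod_eq_one fun i hi => Int.sign_eq_one_of_pos ?_
  rw [Finset.mem_Icc] at hi
  omega

/-- An odd function that preserves the ranges and is increasing along the positive roots fixes
`2, …, n`, and maps `1` to `1` or `-1`. -/
theorem apply_eq_of_strictMono_on_roots (hn : 2 ≤ n) {f : ℤ → ℤ} (hodd : Function.Odd f)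
    (hrange : ∀ x : ℤ, x ≠ 0 → -n ≤ x → x ≤ n → f x ≠ 0 ∧ f x ≤ n)
    (hmono : ∀ i j, IsTypeDRoot n i j → i < j → f i < f j) :
    (∀ k : ℤ, 2 ≤ k → k ≤ n → f k = k) ∧ (f 1 = 1 ∨ f 1 = -1) := by
  have h12 : f 1 < f 2 := hmono 1 2 (by unfold IsTypeDRoot; omega) (by omega)
  have h12' : f (-1) < f 2 := hmono (-1) 2 (by unfold IsTypeDRoot; omega) (by omega)
  rw [hodd] at h12'
  have h1 := (hrange 1 (by omega) (by omega) (by omega)).1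
  -- Squeeze: `f 2` exceeds both `f 1` and `-f 1`, hence is at least `2`, and strict growth bounds
  -- `f` below by the identity; growth towards `f n ≤ n` bounds it above.
  have hlow : ∀ m : ℕ, m + 2 ≤ n → (m : ℤ) + 2 ≤ f (m + 2) := by
    intro m
    induction m with
    | zero =>
      intro _
      norm_num
      omega
    | succ m ih =>
      intro hm
      have h3 := ih (by omega)
      have h4 := hmono (m + 2) ((m + 1 : ℕ) + 2) (by unfold IsTypeDRoot; omega) (by omega)
      push_cast at *
      omega
  have hhigh : ∀ m : ℕ, m + 2 ≤ n → f ((n : ℤ) - m) ≤ n - m := by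
    intro m
    induction m with
    | zero =>
      intro _
      have := (hrange n (by omega) (by omega) (by omega)).2
      simpa using this
    | succ m ih =>
      intro hm
      have h3 := ih (by omega)
      have h4 := hmono ((n : ℤ) - (m + 1 : ℕ)) (n - m) (by unfold IsTypeDRoot; omega) (by omega)
      push_cast at *
      omega
  have hfix : ∀ k : ℤ, 2 ≤ k → k ≤ n → f k = k := by
    intro k hk hkn
    have h3 := hlow (k - 2).toNat (by omega)
    have h4 := hhigh (n - k).toNat (by omega)
    rw [Int.toNat_of_nonneg (by omega)] at h3 h4
    rw [sub_add_cancel] at h3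
    rw [sub_sub_cancel] at h4
    omega
  refine ⟨hfix, ?_⟩
  have := hfix 2 le_rfl (by omega)
  omega

theorem Icc_one_eq_insert (hn : 2 ≤ n) :
    Finset.Icc (1 : ℤ) n = insert 1 (Finset.Icc (2 : ℤ) n) := by
  ext i
  rw [Finset.mem_insert, Finset.mem_Icc, Finset.mem_Icc]
  omega

theorem typeD_range (hn : 2 ≤ n) {w : Equiv.Perm ℤ}
    (hw : w ∈ Subgroup.closure (typeDGenerators n)) (x : ℤ) (h0 : x ≠ 0) (h1 : -n ≤ x)
    (h2 : x ≤ n) : w x ≠ 0 ∧ -n ≤ w x ∧ w x ≤ n := by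
  refine ⟨fun e => ?_, typeD_apply_mem hn hw ⟨h1, h2⟩⟩
  have := typeD_odd hn hw x
  rw [e, neg_zero, ← e] at this
  have := w.injective this
  omega

theorem typeD_eq_one_of_strictMono (hn : 2 ≤ n) {w : Equiv.Perm ℤ}
    (hw : w ∈ Subgroup.closure (typeDGenerators n))
    (hmono : ∀ i j, IsTypeDRoot n i j → i < j → w i < w j) : w = 1 := by
  have hodd := typeD_odd hn hw
  obtain ⟨h2, h1⟩ := apply_eq_of_strictMono_on_roots hn hodd
    (fun x a b c => ⟨(typeD_range hn hw x a b c).1, (typeD_range hn hw x a b c).2.2⟩) hmono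
  have hp := prod_sign_eq_one hn hw
  rw [Icc_one_eq_insert hn, Finset.prod_insert (by simp), Finset.prod_eq_one (fun i hi => by
    rw [Finset.mem_Icc] at hi
    rw [h2 i hi.1 hi.2]
    exact Int.sign_eq_one_of_pos (by omega)), mul_one] at hp
  have h1' : w 1 = 1 := by
    rcases h1 with h1 | h1
    · exact h1
    · rw [h1] at hp
      norm_num at hp
  have hpos : ∀ x : ℤ, 0 ≤ x → w x = x := by
    intro x hx
    by_cases hxn : x ≤ n
    · rcases (by omega : x = 0 ∨ x = 1 ∨ 2 ≤ x) with rfl | rfl | h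
      · have := hodd 0
        rw [neg_zero] at this
        omega
      · exact h1'
      · exact h2 x h hxn
    · exact typeD_fixes_of_notMem hn hw x (by omega)
  ext x
  rw [Equiv.Perm.one_apply]
  by_cases hx : 0 ≤ x
  · exact hpos x hx
  · have := hodd x
    rw [hpos (-x) (by omega)] at this
    omega

/-! #### Inversions -/

open Classical in
/-- The positive roots that are negative on the vector `v`. -/
noncomputable def typeDInversions (n : ℕ) (v : ℤ → ℤ) : Finset (ℤ × ℤ) :=
  {p ∈ Finset.Icc (-n : ℤ) n ×ˢ Finset.Icc (-n : ℤ) n |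
    IsTypeDRoot n p.1 p.2 ∧ p.1 < p.2 ∧ v p.2 < v p.1}

theorem mem_typeDInversions {v : ℤ → ℤ} {p : ℤ × ℤ} :
    p ∈ typeDInversions n v ↔ IsTypeDRoot n p.1 p.2 ∧ p.1 < p.2 ∧ v p.2 < v p.1 := by
  simp only [typeDInversions, Finset.mem_filter, Finset.mem_product, Finset.mem_Icc,
    and_iff_right_iff_imp]
  rintro ⟨⟨h1, h2, h3, h4, h5, h6, h7, h8⟩, _⟩
  exact ⟨⟨h2, h3⟩, h5, h6⟩

/-- The reflection matches the remaining inversions, and exactly its own root is lost. That root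
counts as two pairs, whence the `2`. -/
theorem card_typeDInversions_comp (hn : 2 ≤ n) {k : ℕ} (hk : k < n) {v : ℤ → ℤ}
    (hv : Function.Odd v) (hlt : v (typeDHigh k) < v (typeDLow k)) :
    (typeDInversions n fun i => v (typeDPerm k i)).card + 2 = (typeDInversions n v).card := by
  have hs := typeDPerm_mem hn hk
  have hroot := isTypeDRoot_low_high hn hk
  have hlh := typeDLow_lt_typeDHigh k
  have hinv : ∀ x, typeDPerm k (typeDPerm k x) = x := typeDPerm_typeDPerm k
  have hodd := typeDPerm_odd k
  set a := typeDLow k with ha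
  set b := typeDHigh k with hb
  have hsa : typeDPerm k a = b := typeDPerm_low k
  have hsb : typeDPerm k b = a := typeDPerm_high k
  have hsub : ({(a, b), (-b, -a)} : Finset (ℤ × ℤ)) ⊆ typeDInversions n v := by
    intro p hp
    rw [Finset.mem_insert, Finset.mem_singleton] at hp
    rw [mem_typeDInversions]
    unfold IsTypeDRoot at *
    rcases hp with rfl | rfl
    · exact ⟨hroot, hlh, hlt⟩
    · simp only [hv a, hv b]
      omega
  have hne : ((a, b) : ℤ × ℤ) ≠ (-b, -a) := by
    rw [Ne, Prod.mk.injEq]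
    unfold IsTypeDRoot at hroot
    omega
  rw [← Finset.card_sdiff_add_card_eq_card hsub, Finset.card_pair hne]
  congr 1
  have hpair : ∀ p : ℤ × ℤ, p ∈ ({(a, b), (-b, -a)} : Finset (ℤ × ℤ)) ↔
      (p.1 = a ∧ p.2 = b) ∨ (p.1 = -b ∧ p.2 = -a) := by
    intro p
    rw [Finset.mem_insert, Finset.mem_singleton, Prod.ext_iff, Prod.ext_iff]
  refine Finset.card_nbij' (fun p => (typeDPerm k p.1, typeDPerm k p.2))
    (fun p => (typeDPerm k p.1, typeDPerm k p.2)) ?_ ?_ ?_ ?_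
  · intro p hp
    rw [Finset.mem_coe, mem_typeDInversions] at hp
    rw [Finset.mem_coe, Finset.mem_sdiff, mem_typeDInversions, hpair]
    obtain ⟨h1, h2, h3⟩ := hp
    refine ⟨⟨h1.map hn hs, ?_, h3⟩, ?_⟩
    · rcases typeDPerm_lt_typeDPerm (k := k) h1 h2 with h | ⟨h, h'⟩ | ⟨h, h'⟩
      · exact h
      · rw [h, h', ← ha, ← hb, hsa, hsb] at h3
        omega
      · rw [h, h', ← ha, ← hb, hodd, hodd, hsa, hsb, hv, hv] at h3
        omega
    · dsimp only
      rintro (⟨h, h'⟩ | ⟨h, h'⟩)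
      · have e1 := hinv p.1
        have e2 := hinv p.2
        rw [h, hsa] at e1
        rw [h', hsb] at e2
        omega
      · have e1 := hinv p.1
        have e2 := hinv p.2
        rw [h, hodd, hsb] at e1
        rw [h', hodd, hsa] at e2
        omega
  · intro p hp
    rw [Finset.mem_coe, Finset.mem_sdiff, mem_typeDInversions, hpair] at hp
    rw [Finset.mem_coe, mem_typeDInversions]
    obtain ⟨⟨h1, h2, h3⟩, h4⟩ := hp
    refine ⟨h1.map hn hs, ?_, by simpa only [hinv] using h3⟩
    exact (typeDPerm_lt_typeDPerm (k := k) h1 h2).resolve_right h4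
  · exact fun p _ => Prod.ext (hinv _) (hinv _)
  · exact fun p _ => Prod.ext (hinv _) (hinv _)

theorem card_typeDInversions_comp_of_lt (hn : 2 ≤ n) {k : ℕ} (hk : k < n) {v : ℤ → ℤ}
    (hv : Function.Odd v) (hlt : v (typeDLow k) < v (typeDHigh k)) :
    (typeDInversions n fun i => v (typeDPerm k i)).card = (typeDInversions n v).card + 2 := by
  have h := card_typeDInversions_comp hn hk (v := fun i => v (typeDPerm k i))
    (fun x => by simp only [typeDPerm_odd k x, hv (typeDPerm k x)]) (by rwa [typeDPerm_high, typeDPerm_low])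
  simp only [typeDPerm_typeDPerm] at h
  exact h.symm

/-- A vector that is nonnegative on the simple roots is nonnegative on the positive roots. -/
theorem le_of_dominant (hn : 2 ≤ n) {v : ℤ → ℤ} (hv : Function.Odd v)
    (hdom : ∀ k < n, v (typeDLow k) ≤ v (typeDHigh k)) {i j : ℤ} (hij : IsTypeDRoot n i j)
    (hlt : i < j) : v i ≤ v j := by
  have hmono : ∀ m : ℕ, ∀ i : ℤ, 1 ≤ i → i + m ≤ n → v i ≤ v (i + m) := by
    intro m
    induction m with
    | zero => simp
    | succ m ih =>
      intro i h1 h2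
      have h3 := hdom (i + m).toNat (by omega)
      unfold typeDLow typeDHigh at h3
      rw [if_neg (by omega), if_neg (by omega), Int.toNat_of_nonneg (by omega)] at h3
      have := ih i h1 (by omega)
      push_cast
      rw [← add_assoc]
      omega
  have hmono' : ∀ i j : ℤ, 1 ≤ i → i ≤ j → j ≤ n → v i ≤ v j := by
    intro i j h1 h2 h3
    have := hmono (j - i).toNat i h1 (by omega)
    rwa [Int.toNat_of_nonneg (by omega), add_sub_cancel] at this
  have h0 := hdom 0 (by omega)
  unfold typeDLow typeDHigh at h0
  rw [if_pos rfl, if_pos rfl, hv] at h0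
  have h12 := hmono' 1 2 (by omega) (by omega) (by omega)
  obtain ⟨h1, h2, h3, h4, h5, h6, h7, h8⟩ := hij
  by_cases hi : 0 < i
  · exact hmono' i j (by omega) (by omega) (by omega)
  · have hvi := hv i
    by_cases hj : 0 < j
    · have h9 := hmono' 1 (-i) (by omega) (by omega) (by omega)
      have h10 := hmono' 1 j (by omega) (by omega) (by omega)
      rcases lt_or_gt_of_ne (show -i ≠ j by omega) with h | h
      · have := hmono' 2 j (by omega) (by omega) (by omega)
        omega
      · have := hmono' 2 (-i) (by omega) (by omega) (by omega)
        omega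
    · have hvj := hv j
      have := hmono' (-j) (-i) (by omega) (by omega) (by omega)
      omega

theorem lt_of_strictly_dominant (hn : 2 ≤ n) {v : ℤ → ℤ} (hv : Function.Odd v)
    (hdom : ∀ k < n, v (typeDLow k) < v (typeDHigh k)) {i j : ℤ} (hij : IsTypeDRoot n i j)
    (hlt : i < j) : v i < v j := by
  -- Neighbouring entries `typeDLow k`, `typeDHigh k` differ by at most `3` (attained by the fork)
  -- while `v` jumps by at least `1`, so `3v - id` is still dominant; this gives `3 (v j - v i) ≥ j
  -- - i > 0`.
  have := le_of_dominant hn (v := fun i => 3 * v i - i) (fun x => by simp only [hv x]; ring)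
    (fun k hk => by
      have h1 := hdom k hk
      have h2 : typeDHigh k ≤ typeDLow k + 3 := by
        unfold typeDLow typeDHigh
        split_ifs <;> first | contradiction | omega
      omega) hij hlt
  omega

/-- Reflecting in a violated simple root removes inversions, so the process stops. -/
theorem exists_dominant (hn : 2 ≤ n) {v : ℤ → ℤ} (hv : Function.Odd v) :
    ∃ w ∈ Subgroup.closure (typeDGenerators n),
      ∀ k < n, v (w (typeDLow k)) ≤ v (w (typeDHigh k)) := by
  induction hN : (typeDInversions n v).card using Nat.strong_induction_on generalizing v with
  | _ N ih =>
    by_cases h : ∀ k < n, v (typeDLow k) ≤ v (typeDHigh k)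
    · exact ⟨1, one_mem _, h⟩
    · push Not at h
      obtain ⟨k, hk, hlt⟩ := h
      have hcard := card_typeDInversions_comp hn hk hv hlt
      obtain ⟨w, hw, hdom⟩ := ih _ (by omega) (v := fun i => v (typeDPerm k i))
        (fun x => by simp only [typeDPerm_odd k x, hv (typeDPerm k x)]) rfl
      exact ⟨typeDPerm k * w, mul_mem (typeDPerm_mem hn hk) hw, hdom⟩

theorem typeD_eq_one_or_exists_descent (hn : 2 ≤ n) {w : Equiv.Perm ℤ}
    (hw : w ∈ Subgroup.closure (typeDGenerators n)) :
    w = 1 ∨ ∃ k < n, w (typeDHigh k) < w (typeDLow k) := by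
  by_contra! h
  refine h.1 (typeD_eq_one_of_strictMono hn hw fun i j hij hlt =>
    lt_of_strictly_dominant hn (typeD_odd hn hw) (fun k hk => ?_) hij hlt)
  exact lt_of_le_of_ne (h.2 k hk) fun e => (typeDLow_lt_typeDHigh k).ne (w.injective e)

/-- The closed fundamental chamber meets each orbit once. At a descent of `w` the two dominance
conditions force equality, so the corresponding reflection can be cancelled from `w` without
changing `v ∘ w`. -/
theorem comp_eq_of_dominant (hn : 2 ≤ n) {v : ℤ → ℤ} (hv : Function.Odd v)
    (hdom : ∀ k < n, v (typeDLow k) ≤ v (typeDHigh k)) {w : Equiv.Perm ℤ}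
    (hw : w ∈ Subgroup.closure (typeDGenerators n))
    (hdom' : ∀ k < n, v (w (typeDLow k)) ≤ v (w (typeDHigh k))) (x : ℤ) : v (w x) = v x := by
  induction hN : (typeDInversions n w).card using Nat.strong_induction_on generalizing w x with
  | _ N ih =>
    rcases typeD_eq_one_or_exists_descent hn hw with rfl | ⟨k, hk, hlt⟩
    · rfl
    have hodd := typeD_odd hn hw
    have hcard := card_typeDInversions_comp hn hk hodd hlt
    have hroot := (isTypeDRoot_low_high hn hk).map hn hw
    have he : v (w (typeDLow k)) = v (w (typeDHigh k)) :=
      le_antisymm (hdom' k hk) (le_of_dominant hn hv hdom hroot.symm hlt)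
    have hcomp : ∀ y, v (w (typeDPerm k y)) = v (w y) := by
      intro y
      rw [typeDPerm_apply]
      split_ifs with h1 h2 h3 h4
      · rw [h1, he]
      · rw [h2, he]
      · rw [h3, hodd, hodd, hv, hv, he]
      · rw [h4, hodd, hodd, hv, hv, he]
      · rfl
    rw [← hcomp]
    have hlt' : (typeDInversions n (w * typeDPerm k : Equiv.Perm ℤ)).card < N := by
      rw [← hN, ← hcard]
      exact Nat.lt_add_of_pos_right two_pos
    refine ih _ hlt' (w := w * typeDPerm k) (mul_mem hw (typeDPerm_mem hn hk))
      (fun l hl => ?_) x rfl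
    rw [Equiv.Perm.mul_apply, Equiv.Perm.mul_apply, hcomp, hcomp]
    exact hdom' l hl

/-- Move the negative of the base chamber back to the base chamber by `w`. Then `-w` increases along
positive roots, so it is the identity up to the sign at `1`, which parity settles. -/
theorem exists_antipode (hn : 2 ≤ n) (heven : Even n) :
    ∃ z ∈ Subgroup.closure (typeDGenerators n), ∀ x : ℤ, -n ≤ x → x ≤ n → z x = -x := by
  obtain ⟨w, hw, hdom⟩ := exists_dominant hn (v := fun i => -i) (fun x => rfl)
  have hodd := typeD_odd hn hw
  obtain ⟨h2, h1⟩ := apply_eq_of_strictMono_on_roots hn (f := fun i => -w i)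
    (fun x => by simp only [hodd x])
    (fun x a b c => by
      have := typeD_range hn hw x a b c
      omega)
    (fun i j hij hlt => by
      refine lt_of_strictly_dominant hn (v := fun i => -w i) (fun x => by simp only [hodd x])
        (fun k hk => ?_) hij hlt
      exact lt_of_le_of_ne (hdom k hk) fun e =>
        (typeDLow_lt_typeDHigh k).ne (w.injective (neg_injective e)))
  have hp := prod_sign_eq_one hn hw
  have hneg : ∀ i ∈ Finset.Icc (2 : ℤ) n, (w i).sign = -1 := by
    intro i hi
    rw [Finset.mem_Icc] at hi
    have h3 : w i = -i := by
      have := h2 i hi.1 hi.2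
      omega
    rw [h3, Int.sign_neg, Int.sign_eq_one_of_pos (by omega)]
  rw [Icc_one_eq_insert hn, Finset.prod_insert (by simp), Finset.prod_congr rfl hneg,
    Finset.prod_const, Int.card_Icc] at hp
  -- The `n - 1` sign changes at `2, …, n` are odd in number, so `1` must change sign too.
  have hodd' : Odd ((n : ℤ) + 1 - 2).toNat := by
    obtain ⟨m, rfl⟩ := heven
    exact ⟨m - 1, by omega⟩
  rw [hodd'.neg_one_pow] at hp
  have h1' : w 1 = -1 := by
    rcases h1 with h1 | h1
    · omega
    · replace h1 := neg_injective h1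
      rw [h1] at hp
      norm_num at hp
  have hpos : ∀ x : ℤ, 0 ≤ x → x ≤ n → w x = -x := by
    intro x hx hxn
    rcases (by omega : x = 0 ∨ x = 1 ∨ 2 ≤ x) with rfl | rfl | h
    · have := hodd 0
      rw [neg_zero] at this
      omega
    · exact h1'
    · have := h2 x h hxn
      omega
  refine ⟨w, hw, fun x hx hxn => ?_⟩
  by_cases h : 0 ≤ x
  · exact hpos x h hxn
  · have := hodd x
    rw [hpos (-x) (by omega) (by omega)] at this
    omega

end TypeDCombinatorics

/-! ### Length, faces and the face system of type `D` -/

section TypeDFaces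

variable {n : ℕ}

/-! ### The length function -/

theorem mem_TypeD_generators (hn : 2 ≤ n) {s : TypeD n} :
    s ∈ TypeD.generators n ↔ ∃ k < n, (s : Equiv.Perm ℤ) = typeDPerm k :=
  mem_typeDGenerators hn

theorem card_typeDInversions_mul (hn : 2 ≤ n) {k : ℕ} (hk : k < n) {w : Equiv.Perm ℤ}
    (hw : w ∈ Subgroup.closure (typeDGenerators n)) :
    (w (typeDLow k) < w (typeDHigh k) ∧ (typeDInversions n (w * typeDPerm k : Equiv.Perm ℤ)).card =
      (typeDInversions n w).card + 2) ∨
    (w (typeDHigh k) < w (typeDLow k) ∧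
      (typeDInversions n (w * typeDPerm k : Equiv.Perm ℤ)).card + 2 =
        (typeDInversions n w).card) := by
  rcases lt_trichotomy (w (typeDLow k)) (w (typeDHigh k)) with h | h | h
  · exact Or.inl ⟨h, card_typeDInversions_comp_of_lt hn hk (typeD_odd hn hw) h⟩
  · exact absurd (w.injective h) (typeDLow_lt_typeDHigh k).ne
  · exact Or.inr ⟨h, card_typeDInversions_comp hn hk (typeD_odd hn hw) h⟩

theorem card_typeDInversions_le (hn : 2 ≤ n) (l : List (TypeD n))
    (hl : ∀ s ∈ l, s ∈ TypeD.generators n) :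
    (typeDInversions n (l.prod : Equiv.Perm ℤ)).card ≤ 2 * l.length := by
  induction l using List.reverseRecOn with
  | nil =>
    have : typeDInversions n (([] : List (TypeD n)).prod : Equiv.Perm ℤ) = ∅ := by
      refine Finset.eq_empty_of_forall_notMem fun p hp => ?_
      have h := (mem_typeDInversions.1 hp).2
      exact lt_asymm h.1 h.2
    rw [this]
    exact Nat.zero_le _
  | append_singleton l s ih =>
    have h1 := ih fun t ht => hl t (List.mem_append_left _ ht)
    obtain ⟨k, hk, hs⟩ := (mem_TypeD_generators hn).1 (hl s (by simp))
    rw [List.prod_append, List.prod_singleton, Subgroup.coe_mul, hs, List.length_append,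
      List.length_singleton]
    rcases card_typeDInversions_mul hn hk l.prod.2 with h | h <;> omega

theorem exists_word (hn : 2 ≤ n) (w : TypeD n) :
    ∃ l : List (TypeD n), (∀ s ∈ l, s ∈ TypeD.generators n) ∧ l.prod = w ∧
      2 * l.length = (typeDInversions n (w : Equiv.Perm ℤ)).card := by
  induction hN : (typeDInversions n (w : Equiv.Perm ℤ)).card using Nat.strong_induction_on
    generalizing w with
  | _ N ih =>
    rcases typeD_eq_one_or_exists_descent hn w.2 with h | ⟨k, hk, hlt⟩
    · have hw : w = 1 := Subtype.ext h
      have := card_typeDInversions_le hn [] (by simp)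
      rw [List.prod_nil, ← hw, hN, List.length_nil] at this
      exact ⟨[], by simp, hw.symm, by rw [List.length_nil]; omega⟩
    · let s : TypeD n := ⟨typeDPerm k, typeDPerm_mem hn hk⟩
      have hs : s * s = 1 := Subtype.ext (Equiv.ext (typeDPerm_typeDPerm k))
      have hcard : (typeDInversions n ((w * s : TypeD n) : Equiv.Perm ℤ)).card + 2 = N := by
        rcases card_typeDInversions_mul hn hk w.2 with h | h
        · exact absurd hlt (lt_asymm h.1)
        · exact h.2.trans hN
      obtain ⟨l, h1, h2, h3⟩ := ih _ (by omega) (w * s) rfl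
      refine ⟨l ++ [s], ?_, ?_, ?_⟩
      · intro t ht
        rw [List.mem_append, List.mem_singleton] at ht
        rcases ht with ht | rfl
        · exact h1 t ht
        · exact (mem_TypeD_generators hn).2 ⟨k, hk, rfl⟩
      · rw [List.prod_append, List.prod_singleton, h2, mul_assoc, hs, mul_one]
      · rw [List.length_append, List.length_singleton]
        omega

/-- A generator changes the number of inversion pairs by exactly `2`, and a nontrivial element
always has a generator that lowers it. -/
theorem two_mul_wordLength (hn : 2 ≤ n) (w : TypeD n) :
    2 * wordLength (TypeD.generators n) w = (typeDInversions n (w : Equiv.Perm ℤ)).card := by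
  obtain ⟨l, h1, h2, h3⟩ := exists_word hn w
  refine le_antisymm ?_ ?_
  · rw [← h3]
    exact Nat.mul_le_mul_left 2 (Nat.sInf_le ⟨l, h1, h2, rfl⟩)
  · obtain ⟨l', h1', h2', h3'⟩ := Nat.sInf_mem
      (s := {k | ∃ l : List (TypeD n), (∀ s ∈ l, s ∈ TypeD.generators n) ∧ l.prod = w ∧
        l.length = k}) ⟨_, l, h1, h2, rfl⟩
    have := card_typeDInversions_le hn l' h1'
    rw [h2', h3'] at this
    exact this

/-- The generators, indexed by `Fin n`. -/
def typeDGen (hn : 2 ≤ n) (k : Fin n) : TypeD n := ⟨typeDPerm k, typeDPerm_mem hn k.2⟩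

theorem mem_distinguishedReps_iff (hn : 2 ≤ n) (w : TypeD n) (J : Finset (Fin n)) :
    w ∈ distinguishedReps (TypeD.generators n) (typeDGen hn '' J) ↔
      ∀ k ∈ J, w.1 (typeDLow k) < w.1 (typeDHigh k) := by
  rw [distinguishedReps, Set.mem_ofPred_eq, Set.forall_mem_image]
  refine forall₂_congr fun k _ => ?_
  have h1 := two_mul_wordLength hn w
  have h2 := two_mul_wordLength hn (w * typeDGen hn k)
  have h3 := card_typeDInversions_mul hn k.2 w.2
  have h4 : ((w * typeDGen hn k : TypeD n) : Equiv.Perm ℤ) = w.1 * typeDPerm k := rfl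
  rw [h4] at h2
  omega

/-! ### Faces -/

/-- The positive part of the sign vector of `v`: the roots that are positive on `v`. -/
def typeDPositive (n : ℕ) (v : ℤ → ℤ) : Set (ℤ × ℤ) :=
  {p | IsTypeDRoot n p.1 p.2 ∧ v p.1 < v p.2}

theorem exists_scale (n : ℕ) (v : ℤ → ℤ) :
    ∃ M : ℤ, ∀ i j, IsTypeDRoot n i j → v j - v i < M := by
  obtain ⟨M, hM⟩ := Finset.exists_le ((Finset.Icc (-n : ℤ) n ×ˢ Finset.Icc (-n : ℤ) n).image
    fun p => v p.2 - v p.1)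
  refine ⟨M + 1, fun i j h => Int.lt_add_one_of_le (hM _ (Finset.mem_image.2 ⟨(i, j), ?_, rfl⟩))⟩
  obtain ⟨h1, h2, h3, h4, h5, h6, h7, h8⟩ := h
  rw [Finset.mem_product, Finset.mem_Icc, Finset.mem_Icc]
  exact ⟨⟨h2, h3⟩, h5, h6⟩

/-- Adding a small multiple of `v'` to `v` compares entries lexicographically. -/
theorem exists_lex (n : ℕ) {v v' : ℤ → ℤ} (hv : Function.Odd v) (hv' : Function.Odd v') :
    ∃ u : ℤ → ℤ, Function.Odd u ∧ ∀ i j, IsTypeDRoot n i j →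
      (u i < u j ↔ v i < v j ∨ (v i = v j ∧ v' i < v' j)) := by
  obtain ⟨M, hM⟩ := exists_scale n v'
  refine ⟨fun i => M * v i + v' i, fun x => by simp only [hv x, hv' x]; ring, fun i j h => ?_⟩
  have h1 := hM i j h
  have h2 := hM j i h.symm
  simp only
  constructor
  · intro h3
    rcases lt_trichotomy (v i) (v j) with h4 | h4 | h4
    · exact Or.inl h4
    · rw [h4] at h3
      exact Or.inr ⟨h4, by linarith⟩
    · have : M * 1 ≤ M * (v i - v j) := by
        refine mul_le_mul_of_nonneg_left ?_ ?_ <;> omega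
      nlinarith
  · rintro (h3 | ⟨h3, h4⟩)
    · have : M * 1 ≤ M * (v j - v i) := by
        refine mul_le_mul_of_nonneg_left ?_ ?_ <;> omega
      nlinarith
    · rw [h3]
      omega

theorem lex_typeDPositive {u v v' : ℤ → ℤ} (h : ∀ i j, IsTypeDRoot n i j →
    (u i < u j ↔ v i < v j ∨ (v i = v j ∧ v' i < v' j))) :
    {p | p ∈ typeDPositive n v ∨
      (p ∉ typeDPositive n v ∧ p.swap ∉ typeDPositive n v ∧ p ∈ typeDPositive n v')} =
      typeDPositive n u := by
  ext p
  simp only [typeDPositive, Set.mem_ofPred_eq, Prod.fst_swap, Prod.snd_swap]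
  by_cases hp : IsTypeDRoot n p.1 p.2
  · rw [h _ _ hp]
    simp only [hp, hp.symm, true_and, not_lt]
    refine or_congr_right ?_
    rw [← and_assoc, ← le_antisymm_iff, eq_comm]
  · simp only [hp, false_and, and_false, or_false]

variable (n) in
/-- The faces of the reflection arrangement, given by the sets of roots that are positive on the
points of the face. -/
def TypeDFace : Type := {f : Set (ℤ × ℤ) // ∃ v, Function.Odd v ∧ f = typeDPositive n v}

namespace TypeDFace

/-- The face that contains the point `v`. -/
def mk (n : ℕ) (v : ℤ → ℤ) (hv : Function.Odd v) : TypeDFace n := ⟨typeDPositive n v, v, hv, rfl⟩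

theorem exists_mk (f : TypeDFace n) : ∃ v hv, f = mk n v hv := by
  obtain ⟨_, v, hv, rfl⟩ := f
  exact ⟨v, hv, rfl⟩

theorem mk_eq_mk {v v' : ℤ → ℤ} {hv : Function.Odd v} {hv' : Function.Odd v'} :
    mk n v hv = mk n v' hv' ↔ ∀ i j, IsTypeDRoot n i j → (v i < v j ↔ v' i < v' j) := by
  refine Subtype.ext_iff.trans (Set.ext_iff.trans (Prod.forall.trans ?_))
  exact forall₂_congr fun i j => and_congr_right_iff

instance : Finite (TypeDFace n) := by
  have hfin : (Set.Icc (-n : ℤ) n ×ˢ Set.Icc (-n : ℤ) n).Finite :=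
    (Set.finite_Icc _ _).prod (Set.finite_Icc _ _)
  refine (Set.Finite.subset hfin.finite_subsets ?_).to_subtype
  rintro _ ⟨v, _, rfl⟩ p ⟨⟨h1, h2, h3, h4, h5, h6, h7, h8⟩, _⟩
  exact ⟨⟨h2, h3⟩, h5, h6⟩

/-- The Tits product: the face entered on moving slightly from a point of `f` towards `g`.
`exists_lex` supplies an integral point in it. -/
instance : Mul (TypeDFace n) where
  mul f g := ⟨{p | p ∈ f.1 ∨ (p ∉ f.1 ∧ p.swap ∉ f.1 ∧ p ∈ g.1)}, by
    obtain ⟨_, v, hv, rfl⟩ := f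
    obtain ⟨_, v', hv', rfl⟩ := g
    obtain ⟨u, hu, h⟩ := exists_lex n hv hv'
    exact ⟨u, hu, lex_typeDPositive h⟩⟩

theorem mem_mul (f g : TypeDFace n) (p : ℤ × ℤ) :
    p ∈ (f * g).1 ↔ p ∈ f.1 ∨ (p ∉ f.1 ∧ p.swap ∉ f.1 ∧ p ∈ g.1) := Iff.rfl

instance : One (TypeDFace n) where
  one := ⟨∅, fun _ => 0, fun _ => rfl, by simp [typeDPositive]⟩

theorem notMem_one (p : ℤ × ℤ) : p ∉ (1 : TypeDFace n).1 := Set.notMem_empty p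

theorem ext_iff {f g : TypeDFace n} : f = g ↔ ∀ p, p ∈ f.1 ↔ p ∈ g.1 :=
  Subtype.ext_iff.trans Set.ext_iff

instance : Monoid (TypeDFace n) where
  mul_assoc f g h := ext_iff.2 fun p => by
    simp only [mem_mul, Prod.swap_swap]
    tauto
  one_mul f := ext_iff.2 fun p => by
    simp only [mem_mul, notMem_one, not_false_eq_true, true_and, false_or]
  mul_one f := ext_iff.2 fun p => by
    simp only [mem_mul, notMem_one, and_false, or_false]

theorem mul_self (f : TypeDFace n) : f * f = f := ext_iff.2 fun p => by
  rw [mem_mul]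
  tauto

theorem mk_mul_mk {v v' : ℤ → ℤ} {hv : Function.Odd v} {hv' : Function.Odd v'} :
    ∃ u hu, mk n v hv * mk n v' hv' = mk n u hu ∧ ∀ i j, IsTypeDRoot n i j →
      (u i < u j ↔ v i < v j ∨ (v i = v j ∧ v' i < v' j)) := by
  obtain ⟨u, hu, h⟩ := exists_lex n hv hv'
  exact ⟨u, hu, Subtype.ext (lex_typeDPositive h), h⟩

variable [hn : Fact (2 ≤ n)]

theorem odd_comp_inv {v : ℤ → ℤ} (hv : Function.Odd v) (w : TypeD n) :
    Function.Odd fun i => v (w.1⁻¹ i) := fun x => by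
  simp only [typeD_odd hn.out (inv_mem w.2) x, hv (w.1⁻¹ x)]

theorem preimage_typeDPositive (v : ℤ → ℤ) (w : TypeD n) :
    {p : ℤ × ℤ | (w.1⁻¹ p.1, w.1⁻¹ p.2) ∈ typeDPositive n v} =
      typeDPositive n fun i => v (w.1⁻¹ i) := by
  ext p
  refine and_congr_left fun _ => ⟨fun h => ?_, fun h => h.map hn.out (inv_mem w.2)⟩
  have := h.map hn.out w.2
  simpa only [show ∀ i, w.1 (w.1⁻¹ i) = i from Equiv.apply_symm_apply w.1] using this

instance : MulDistribMulAction (TypeD n) (TypeDFace n) where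
  smul w f := ⟨{p | (w.1⁻¹ p.1, w.1⁻¹ p.2) ∈ f.1}, by
    obtain ⟨_, v, hv, rfl⟩ := f
    exact ⟨_, odd_comp_inv hv w, preimage_typeDPositive v w⟩⟩
  one_smul f := rfl
  mul_smul w w' f := Subtype.ext <| Set.ext fun p => by
    change ((w * w').1⁻¹ p.1, (w * w').1⁻¹ p.2) ∈ f.1 ↔ _
    rw [Subgroup.coe_mul, mul_inv_rev]
    rfl
  smul_mul w f g := rfl
  smul_one w := rfl

theorem smul_mk (w : TypeD n) {v : ℤ → ℤ} (hv : Function.Odd v) :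
    w • mk n v hv = mk n (fun i => v (w.1⁻¹ i)) (odd_comp_inv hv w) :=
  Subtype.ext (preimage_typeDPositive v w)

end TypeDFace

/-! ### Fundamental coweights -/

/-- The fundamental coweights, up to scaling. -/
def typeDCoweight (k : ℕ) (x : ℤ) : ℤ :=
  if k = 0 then x.sign else if k = 1 then (if -1 ≤ x ∧ x ≤ 1 then -x else x.sign)
  else if -k ≤ x ∧ x ≤ k then 0 else x.sign

theorem typeDCoweight_odd (k : ℕ) : Function.Odd (typeDCoweight k) := by
  intro x
  unfold typeDCoweight
  rw [Int.sign_neg]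
  split_ifs <;> first | contradiction | omega

/-- On `1, …, n` the vectors are `(1, …, 1)` for `k = 0`, `(-1, 1, …, 1)` for `k = 1`, and `k` zeros
followed by ones otherwise; up to scaling they are dual to the simple roots. -/
theorem typeDCoweight_low_high (k l : ℕ) :
    (k ≠ l → typeDCoweight k (typeDLow l) = typeDCoweight k (typeDHigh l)) ∧
      typeDCoweight k (typeDLow k) < typeDCoweight k (typeDHigh k) := by
  have h1 : ∀ x : ℤ, 0 < x → x.sign = 1 := fun x => Int.sign_eq_one_of_pos
  have h2 : (-2 : ℤ).sign = -1 := rfl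
  have h3 : (1 : ℤ).sign = 1 := rfl
  have h4 := h1 ((l : ℤ) + 1) (by omega)
  have h5 := h1 ((k : ℤ) + 1) (by omega)
  have h6 : l ≠ 0 → (l : ℤ).sign = 1 := fun h => h1 l (by omega)
  have h7 : k ≠ 0 → (k : ℤ).sign = 1 := fun h => h1 k (by omega)
  unfold typeDCoweight typeDLow typeDHigh
  constructor
  · intro h
    by_cases hl : l = 0
    · simp only [hl, if_true]
      split_ifs <;> first | contradiction | omega
    · have h6 := h6 hl
      simp only [hl, if_false]
      split_ifs <;> first | contradiction | omega
  · by_cases hk : k = 0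
    · simp only [hk, if_true]
      omega
    · have h7 := h7 hk
      simp only [hk, if_false]
      split_ifs <;> first | contradiction | omega

/-- A point of the closed fundamental chamber on exactly the walls indexed by `J`. -/
def typeDPoint {n : ℕ} (J : Finset (Fin n)) (x : ℤ) : ℤ := ∑ k ∈ Jᶜ, typeDCoweight k x

theorem typeDPoint_odd (J : Finset (Fin n)) : Function.Odd (typeDPoint J) := by
  intro x
  rw [typeDPoint, typeDPoint, ← Finset.sum_neg_distrib]
  exact Finset.sum_congr rfl fun k _ => typeDCoweight_odd k x

theorem typeDPoint_eq {J : Finset (Fin n)} {k : Fin n} (hk : k ∈ J) :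
    typeDPoint J (typeDLow k) = typeDPoint J (typeDHigh k) := by
  refine Finset.sum_congr rfl fun l hl => (typeDCoweight_low_high l k).1 fun e => ?_
  rw [Fin.ext e] at hl
  exact Finset.mem_compl.1 hl hk

theorem typeDPoint_lt {J : Finset (Fin n)} {k : Fin n} (hk : k ∉ J) :
    typeDPoint J (typeDLow k) < typeDPoint J (typeDHigh k) := by
  refine Finset.sum_lt_sum (fun l _ => ?_)
    ⟨k, Finset.mem_compl.2 hk, (typeDCoweight_low_high k k).2⟩
  by_cases h : (l : ℕ) = k
  · rw [h]
    exact (typeDCoweight_low_high k k).2.le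
  · exact ((typeDCoweight_low_high l k).1 h).le

theorem typeDPoint_eq_iff {J : Finset (Fin n)} {k : Fin n} :
    typeDPoint J (typeDLow k) = typeDPoint J (typeDHigh k) ↔ k ∈ J :=
  ⟨fun h => by_contra fun hk => (typeDPoint_lt hk).ne h, typeDPoint_eq⟩

theorem typeDPoint_dominant (J : Finset (Fin n)) :
    ∀ k < n, typeDPoint J (typeDLow k) ≤ typeDPoint J (typeDHigh k) := by
  intro k hk
  by_cases h : (⟨k, hk⟩ : Fin n) ∈ J
  · exact (typeDPoint_eq (k := ⟨k, hk⟩) h).le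
  · exact (typeDPoint_lt (k := ⟨k, hk⟩) h).le

theorem typeDPoint_univ : typeDPoint (Finset.univ : Finset (Fin n)) = fun _ => 0 := by
  funext x
  rw [typeDPoint, Finset.compl_univ, Finset.sum_empty]

/-! ### The face system -/

/-- Perturb `v` by a small multiple of `-v'`. As every wall of `v` is a wall of `v'`, the result
stays dominant, so `-v'` is nonnegative on positive roots where `v` vanishes. -/
theorem eq_of_dominant_of_eq (hn : 2 ≤ n) {v v' : ℤ → ℤ} (hv : Function.Odd v)
    (hv' : Function.Odd v') (hdom : ∀ k < n, v (typeDLow k) ≤ v (typeDHigh k))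
    (hdom' : ∀ k < n, v' (typeDLow k) ≤ v' (typeDHigh k))
    (h : ∀ k < n, v (typeDLow k) = v (typeDHigh k) → v' (typeDLow k) = v' (typeDHigh k))
    {i j : ℤ} (hij : IsTypeDRoot n i j) (hlt : i < j) (he : v i = v j) : v' i = v' j := by
  obtain ⟨u, hu, hlex⟩ := exists_lex n hv (v' := fun x => -v' x) fun x => by simp only [hv' x]
  refine le_antisymm (le_of_dominant hn hv' hdom' hij hlt) ?_
  have hdomu : ∀ k < n, u (typeDLow k) ≤ u (typeDHigh k) := by
    intro k hk
    have h1 := hdom k hk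
    rw [← not_lt, hlex _ _ (isTypeDRoot_low_high hn hk).symm]
    rintro (h2 | ⟨h2, h3⟩)
    · omega
    · have := h k hk h2.symm
      omega
  have h1 := le_of_dominant hn hu hdomu hij hlt
  rw [← not_lt, hlex _ _ hij.symm] at h1
  by_contra h2
  exact h1 (Or.inr ⟨he.symm, by omega⟩)

namespace TypeDFace

theorem mk_eq_mk_of_dominant (hn : 2 ≤ n) {v v' : ℤ → ℤ} (hv : Function.Odd v)
    (hv' : Function.Odd v') (hdom : ∀ k < n, v (typeDLow k) ≤ v (typeDHigh k))
    (hdom' : ∀ k < n, v' (typeDLow k) ≤ v' (typeDHigh k))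
    (h : ∀ k < n, v (typeDLow k) = v (typeDHigh k) ↔ v' (typeDLow k) = v' (typeDHigh k)) :
    mk n v hv = mk n v' hv' := by
  rw [mk_eq_mk]
  intro i j hij
  rcases lt_or_gt_of_ne hij.2.2.2.2.2.2.1 with hlt | hlt
  · have h1 := le_of_dominant hn hv hdom hij hlt
    have h2 := le_of_dominant hn hv' hdom' hij hlt
    have h3 := eq_of_dominant_of_eq hn hv hv' hdom hdom' (fun k hk => (h k hk).1) hij hlt
    have h4 := eq_of_dominant_of_eq hn hv' hv hdom' hdom (fun k hk => (h k hk).2) hij hlt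
    omega
  · have h1 := le_of_dominant hn hv hdom hij.symm hlt
    have h2 := le_of_dominant hn hv' hdom' hij.symm hlt
    omega

theorem odd_fun_id : Function.Odd fun i : ℤ => i := fun _ => rfl

variable (n) in
/-- The fundamental chamber. -/
def base : TypeDFace n := mk n (fun i => i) odd_fun_id

theorem mk_eq_base_iff (hn : 2 ≤ n) {v : ℤ → ℤ} (hv : Function.Odd v) :
    mk n v hv = base n ↔ ∀ k < n, v (typeDLow k) < v (typeDHigh k) := by
  rw [base, mk_eq_mk]
  constructor
  · exact fun h k hk => (h _ _ (isTypeDRoot_low_high hn hk)).2 (typeDLow_lt_typeDHigh k)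
  · intro h i j hij
    refine ⟨fun hlt => ?_, lt_of_strictly_dominant hn hv h hij⟩
    by_contra hle
    have h1 := hij.2.2.2.2.2.2.1
    exact lt_asymm hlt (lt_of_strictly_dominant hn hv h hij.symm (by omega))

theorem mk_mul_mk_eq_base_iff (hn : 2 ≤ n) {v v' : ℤ → ℤ} (hv : Function.Odd v)
    (hv' : Function.Odd v') :
    mk n v hv * mk n v' hv' = base n ↔ ∀ k < n, v (typeDLow k) < v (typeDHigh k) ∨
      (v (typeDLow k) = v (typeDHigh k) ∧ v' (typeDLow k) < v' (typeDHigh k)) := by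
  obtain ⟨u, hu, h, hlex⟩ := mk_mul_mk (n := n) (hv := hv) (hv' := hv')
  rw [h, mk_eq_base_iff hn]
  exact forall₂_congr fun k hk => hlex _ _ (isTypeDRoot_low_high hn hk)

theorem mk_mul_base_eq_base_iff (hn : 2 ≤ n) {v : ℤ → ℤ} (hv : Function.Odd v) :
    mk n v hv * base n = base n ↔ ∀ k < n, v (typeDLow k) ≤ v (typeDHigh k) := by
  refine (mk_mul_mk_eq_base_iff hn hv odd_fun_id).trans ?_
  refine forall₂_congr fun k hk => ?_
  have := typeDLow_lt_typeDHigh k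
  omega

variable [hn : Fact (2 ≤ n)]

/-- The face of the fundamental chamber on the walls indexed by `J`. -/
def rep (J : Finset (Fin n)) : TypeDFace n := mk n (typeDPoint J) (typeDPoint_odd J)

theorem rep_empty : rep (∅ : Finset (Fin n)) = base n :=
  (mk_eq_base_iff hn.out _).2 fun k hk =>
    typeDPoint_lt (k := ⟨k, hk⟩) (Finset.notMem_empty _)

theorem smul_base (w : TypeD n) :
    w • base n = mk n (fun i => w.1⁻¹ i) (typeD_odd hn.out (inv_mem w.2)) :=
  smul_mk w _

theorem inv_smul_base (w : TypeD n) :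
    w⁻¹ • base n = mk n (fun i => w.1 i) (typeD_odd hn.out w.2) := by
  rw [smul_base]
  congr 1

theorem exists_eq_smul_base {v : ℤ → ℤ} (hv : Function.Odd v)
    (hreg : ∀ i j, IsTypeDRoot n i j → v i ≠ v j) : ∃ w : TypeD n, mk n v hv = w • base n := by
  obtain ⟨w, hw, hdom⟩ := exists_dominant hn.out hv
  refine ⟨⟨w, hw⟩, ?_⟩
  rw [← inv_smul_eq_iff, smul_mk, mk_eq_base_iff hn.out]
  intro k hk
  exact lt_of_le_of_ne (hdom k hk)
    (hreg _ _ ((isTypeDRoot_low_high hn.out hk).map hn.out hw))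

theorem eq_of_smul_rep_eq (w : TypeD n) (J K : Finset (Fin n)) (h : w • rep J = rep K) : J = K := by
  have hn2 := hn.out
  have hJ := typeDPoint_odd J
  rw [rep, rep, smul_mk] at h
  have h1 : ∀ k < n, typeDPoint J (w.1⁻¹ (typeDLow k)) ≤ typeDPoint J (w.1⁻¹ (typeDHigh k)) := by
    intro k hk
    have := mk_eq_mk.1 h _ _ (isTypeDRoot_low_high hn2 hk).symm
    have := typeDPoint_dominant K k hk
    omega
  have h2 := comp_eq_of_dominant hn2 hJ (typeDPoint_dominant J) (inv_mem w.2) h1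
  ext k
  have h3 := mk_eq_mk.1 h _ _ (isTypeDRoot_low_high hn2 k.2)
  rw [h2, h2] at h3
  have h4 := typeDPoint_dominant J k k.2
  have h5 := typeDPoint_dominant K k k.2
  rw [← typeDPoint_eq_iff, ← typeDPoint_eq_iff]
  omega

/-- After translation by `w⁻¹` the right side says that projecting `w⁻¹ • base n` to `rep J` gives
the base chamber; only the simple roots in `J`, which vanish on `rep J`, impose a condition. -/
theorem mem_distinguishedReps_iff_smul_rep (w : TypeD n) (J : Finset (Fin n)) :
    w ∈ distinguishedReps (TypeD.generators n) (typeDGen hn.out '' J) ↔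
      (w • rep J) * rep ∅ = w • rep ∅ := by
  have hn2 := hn.out
  have h : (w • rep J) * base n = w • base n ↔ rep J * w⁻¹ • base n = base n := by
    rw [← smul_left_cancel_iff w⁻¹, smul_mul', inv_smul_smul, inv_smul_smul]
  rw [mem_distinguishedReps_iff, rep_empty, h, inv_smul_base, rep, mk_mul_mk_eq_base_iff hn2]
  constructor
  · intro h k hk
    by_cases hJ : (⟨k, hk⟩ : Fin n) ∈ J
    · exact Or.inr ⟨typeDPoint_eq (k := ⟨k, hk⟩) hJ, h ⟨k, hk⟩ hJ⟩
    · exact Or.inl (typeDPoint_lt (k := ⟨k, hk⟩) hJ)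
  · intro h k hk
    exact ((h k k.2).resolve_left (typeDPoint_eq hk).not_lt).2

/-- Project the chamber opposite to the base to the face `rep D`: the resulting chamber is negative
on exactly the simple roots in `D`. -/
theorem exists_descents (D : Finset (Fin n)) : ∃ w : TypeD n, ∀ J : Finset (Fin n),
    w ∈ distinguishedReps (TypeD.generators n) (typeDGen hn.out '' J) ↔ Disjoint D J := by
  have hn2 := hn.out
  obtain ⟨u, hu, h, hlex⟩ := mk_mul_mk (n := n) (hv := typeDPoint_odd D) (v' := fun i => -i)
    (hv' := fun _ => rfl)
  obtain ⟨w, hw⟩ := exists_eq_smul_base hu fun i j hij he => by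
    have h1 := hlex i j hij
    have h2 := hlex j i hij.symm
    have h3 := hij.2.2.2.2.2.2.1
    omega
  rw [smul_base, mk_eq_mk] at hw
  refine ⟨w⁻¹, fun J => ?_⟩
  rw [mem_distinguishedReps_iff, Finset.disjoint_right]
  refine forall₂_congr fun k _ => ?_
  have h1 := hw _ _ (isTypeDRoot_low_high hn2 k.2)
  rw [Subgroup.coe_inv, ← h1, hlex _ _ (isTypeDRoot_low_high hn2 k.2), ← typeDPoint_eq_iff]
  have h2 := typeDPoint_dominant D k k.2
  have h3 := typeDLow_lt_typeDHigh k
  omega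

theorem isFaceSystem (heven : Even n) : ∃ z : TypeD n, IsFaceSystem (TypeD n) rep
    (fun J : Finset (Fin n) => distinguishedReps (TypeD.generators n) (typeDGen hn.out '' (J : Set (Fin n)))) z := by
  have hn2 := hn.out
  obtain ⟨z, hz, hneg⟩ := exists_antipode hn2 heven
  have hzz : z * z = 1 := by
    refine Equiv.ext fun x => ?_
    by_cases hx : -n ≤ x ∧ x ≤ n
    · rw [Equiv.Perm.mul_apply, hneg x hx.1 hx.2, typeD_odd hn2 hz, hneg x hx.1 hx.2, neg_neg]
      rfl
    · rw [Equiv.Perm.mul_apply, typeD_fixes_of_notMem hn2 hz x hx,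
        typeD_fixes_of_notMem hn2 hz x hx]
      rfl
  -- The antipode reverses every sign, which on positive parts means swapping the index pair.
  have hzsmul : ∀ (f : TypeDFace n) (p : ℤ × ℤ),
      p ∈ ((⟨z, hz⟩ : TypeD n) • f).1 ↔ p.swap ∈ f.1 := by
    intro f p
    obtain ⟨v, hv, rfl⟩ := exists_mk f
    rw [smul_mk]
    change IsTypeDRoot n p.1 p.2 ∧ v (z⁻¹ p.1) < v (z⁻¹ p.2) ↔ IsTypeDRoot n p.2 p.1 ∧ v p.2 < v p.1
    rw [inv_eq_of_mul_eq_one_left hzz]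
    by_cases hp : IsTypeDRoot n p.1 p.2
    · rw [hneg _ hp.2.1 hp.2.2.1, hneg _ hp.2.2.2.2.1 hp.2.2.2.2.2.1, hv, hv, neg_lt_neg_iff]
      simp only [hp, hp.symm]
    · exact iff_of_false (fun h => hp h.1) fun h => hp h.1.symm
  refine ⟨⟨z, hz⟩, ?_⟩
  constructor
  case mul_self => exact mul_self
  case free =>
    intro w hw
    rw [rep_empty, smul_base, mk_eq_base_iff hn2] at hw
    have := typeD_eq_one_of_strictMono hn2 (inv_mem w.2) fun i j hij hlt =>
      lt_of_strictly_dominant hn2 (typeD_odd hn2 (inv_mem w.2)) hw hij hlt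
    exact Subtype.ext (inv_eq_one.1 this)
  case mul_chamber =>
    intro f
    obtain ⟨v, hv, rfl⟩ := exists_mk f
    rw [rep_empty, base]
    obtain ⟨u, hu, h, hlex⟩ := mk_mul_mk (n := n) (hv := hv) (v' := fun i => i)
      (hv' := odd_fun_id)
    rw [h]
    refine exists_eq_smul_base hu fun i j hij he => ?_
    have h1 := hlex i j hij
    have h2 := hlex j i hij.symm
    have h3 := hij.2.2.2.2.2.2.1
    omega
  case dominant =>
    intro f hf
    obtain ⟨v, hv, rfl⟩ := exists_mk f
    rw [rep_empty, mk_mul_base_eq_base_iff hn2] at hf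
    refine ⟨Finset.univ.filter fun k : Fin n => v (typeDLow k) = v (typeDHigh k),
      mk_eq_mk_of_dominant hn2 hv _ hf (typeDPoint_dominant _) fun k hk => ?_⟩
    rw [typeDPoint_eq_iff (k := ⟨k, hk⟩), Finset.mem_filter]
    exact ⟨fun h => ⟨Finset.mem_univ _, h⟩, fun h => h.2⟩
  case rep_mul_chamber =>
    intro J
    rw [rep_empty, rep, mk_mul_base_eq_base_iff hn2]
    exact typeDPoint_dominant J
  case rep_injective => exact eq_of_smul_rep_eq
  case mem_iff => exact mem_distinguishedReps_iff_smul_rep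
  case left_mul_chamber =>
    intro g f h
    obtain ⟨v, hv, rfl⟩ := exists_mk g
    rw [rep_empty, mul_assoc] at h
    obtain ⟨u, hu, he⟩ := exists_mk (f * base n)
    rw [he, mk_mul_mk_eq_base_iff hn2] at h
    rw [rep_empty, mk_mul_base_eq_base_iff hn2]
    exact fun k hk => (h k hk).elim le_of_lt fun h' => h'.1.le
  case subset_of_rep_mul =>
    intro K L f h k hk
    by_contra hK
    have h1 : (typeDLow k, typeDHigh k) ∈ (rep K).1 :=
      ⟨isTypeDRoot_low_high hn2 k.2, typeDPoint_lt hK⟩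
    have h2 : (typeDLow k, typeDHigh k) ∈ (rep K * f).1 := Or.inl h1
    rw [h] at h2
    exact h2.2.ne (typeDPoint_eq hk)
  case rep_univ =>
    refine ext_iff.2 fun p => ⟨fun hp => ?_, fun hp => absurd hp (notMem_one p)⟩
    have := hp.2
    rw [typeDPoint_univ] at this
    exact absurd this (lt_irrefl _)
  case antipode_antipode => exact Subtype.ext hzz
  case eq_one_of_antipode =>
    intro f hf
    refine ext_iff.2 fun p => ⟨fun hp => ?_, fun hp => absurd hp (notMem_one p)⟩
    have h1 : p.swap ∈ f.1 := by rwa [← hzsmul, hf]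
    obtain ⟨v, hv, rfl⟩ := exists_mk f
    exact absurd hp.2 (lt_asymm h1.2)
  case mul_antipode =>
    intro g f h
    refine ext_iff.2 fun p => ?_
    -- `g * f = g` says that `f` vanishes on all roots where `g` does, a condition unchanged by
    -- negating `f`.
    have h1 := ext_iff.1 h p.swap
    rw [mem_mul, Prod.swap_swap] at h1
    rw [mem_mul, hzsmul]
    tauto
  case exists_descents => exact exists_descents

end TypeDFace

end TypeDFaces

/-! ### Conclusion for the descent algebra of type `D` -/

theorem lemma4p9 (F : Type u) [Field F] [IsAlgClosed F] [CharP F 2]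
    (n : ℕ) (hn : 4 ≤ n) (hn_even : Even n) :
    ∃ v : ExtQuiver F (descentAlgebraD F n),
      (∀ w : ExtQuiver F (descentAlgebraD F n), w = v) ∧ n ≤ Nat.card (v ⟶ v) := by
  have hn2 : Fact (2 ≤ n) := ⟨by omega⟩
  obtain ⟨z, hz⟩ := TypeDFace.isFaceSystem hn_even
  have hrange : Set.range (typeDGen hn2.out) = TypeD.generators n := by
    ext s
    rw [mem_TypeD_generators hn2.out]
    constructor
    · rintro ⟨k, rfl⟩
      exact ⟨k, k.2, rfl⟩
    · rintro ⟨k, hk, h⟩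
      exact ⟨⟨k, hk⟩, Subtype.ext h.symm⟩
  have h := exists_unique_vertex_of_adjoin_triangular _ (hz.linearIndependent_setSum (F := F))
    hz.setSum_X_univ (fun J K hJ => hz.setSum_mul_mem_span J K hJ) (descentAlgebra F (TypeD.generators n)) (by
      -- Subsets of the generating set are exactly the images of subsets of `Fin n`, so both
      -- families generate the same algebra.
      refine congrArg (Algebra.adjoin F) (Set.ext fun x => ⟨?_, ?_⟩)
      · rintro ⟨J, hJ, rfl⟩
        classical
        refine ⟨Finset.univ.filter fun k => typeDGen hn2.out k ∈ J, ?_⟩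
        have : typeDGen hn2.out '' (Finset.univ.filter fun k => typeDGen hn2.out k ∈ J) = J := by
          ext s
          simp only [Finset.coe_filter, Finset.mem_univ, true_and]
          constructor
          · rintro ⟨k, hk, rfl⟩
            exact hk
          · intro hs
            obtain ⟨k, rfl⟩ := hrange.ge (hJ hs)
            exact ⟨k, hs, rfl⟩
        simp only [this]
        rfl
      · rintro ⟨J, rfl⟩
        exact ⟨_, (Set.image_subset_range _ _).trans hrange.le, rfl⟩)
  rwa [Fintype.card_fin] at h
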